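/- Consider vectors $|\phi\rangle\in\mathcal H_1\otimes\mathcal H_2$ with $\mathcal H_1,\mathcal H_2$ finite-dimensional complex Hilbert spaces (unnormalised bipartite pure states). Local unitary equivalence: $|\phi\rangle\in\mathcal H_1\otimes\mathcal H_2$ and $|\psi\rangle\in\mathcal H_1'\otimes\mathcal H_2'$ are equivalent if there are partial isometries $U_i:\mathcal H_i\to\mathcal H_i'$ with $|\psi\rangle=(U_1\otimes U_2)|\phi\rangle$ and $|\phi\rangle=(U_1^*\otimes U_2^*)|\psi\rangle$. Let $\mathcal S_2$ be the commutative semiring of equivalence classes, with addition $\oplus$ (direct sum, in $(\mathcal H_1\oplus\mathcal H_1')\otimes(\mathcal H_2\oplus\mathcal H_2')$) and multiplication $\otimes$ (tensor product, in $(\mathcal H_1\otimes\mathcal H_1')\otimes(\mathcal H_2\otimes\mathcal H_2')$), zero $[0]$ and unit $[|00\rangle]$ with $|00\rangle\in\mathbb C\otimes\mathbb C$. LOCC: for finite sets $\mathcal X,\mathcal Y$ (classical registers), a one-step LOCC channel is a map from $\mathcal B(\mathcal H_1)\otimes\mathcal B(\mathcal H_2)\otimes\mathrm{Diag}(\mathbb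 C^{\mathcal X})$ to $\mathcal B(\mathcal H'_1)\otimes\mathcal B(\mathcal H'_2)\otimes\mathrm{Diag}(\mathbb C^{\mathcal Y})$ of the form \[ \rho\mapsto\sum_{j\in J}\bigl((K_j)_i\otimes|g(j)\rangle\langle f(j)|\bigr)\,\rho\,\bigl((K_j)_i^*\otimes|f(j)\rangle\langle g(j)|\bigr), \] where $i\in\{1,2\}$, $J$ is a finite set, $f:J\to\mathcal X$ and $g:J\to\mathcal Y$ are maps, and $(K_j)_i$ is a linear map $K_j:\mathcal H_i\to\mathcal H_i'$ applied to the $i$-th system (the other system is unchanged), subject to $\sum_j K_j^*K_j\otimes|f(j)\rangle\langle f(j)|\le I$. An LOCC channel is a composition of finitely many one-step LOCC channels. Write $|\psi\rangle\to|\phi\rangle$ if some LOCC channel (with one-point initial and final registers) maps $|\psi\rangle\langle\psi|$ to $|\phi\rangle\langle\phi|$, and preorder $\mathcal S_2$ by $[|\phi\rangle]\le[|\psi\rangle]$ iff $|\psi\rangle\to|\phi\rangle$. Let $\Delta(\mathcal S_2)$, the bipartite asymptotic LOCC spectrum, be the set of order-preserving semiring homomorphisms $\mathcal S_2\to[0,\infty)$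 (sending $0$ to $0$ and $1$ to $1$). Theorem. Regarding functions on $\mathcal S_2$ as functions of representatives, \[ \Delta(\mathcal S_2)=\{f_\alpha:\alpha\in[0,1]\},\qquad f_\alpha(|\phi\rangle)=\mathrm{Tr}\bigl[(\mathrm{Tr}_2|\phi\rangle\langle\phi|)^\alpha\bigr], \] where $\mathrm{Tr}_2$ is the partial trace over the second system and powers of a positive semidefinite operator are taken on its support (so $\rho^0$ is the projection onto the support of $\rho$). Equivalently, $f_\alpha(|\phi\rangle)=\sum_i p_i^\alpha$ for every $\alpha\in[0,1]$ and every Schmidt decomposition $|\phi\rangle=\sum_i\sqrt{p_i}\,u_i\otimes v_i$ with all $p_i>0$ and with orthonormal families $(u_i)$, $(v_i)$. -/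

import Mathlib

open scoped Kronecker NNReal ComplexOrder

/-- A vector in the tensor product `ℂ^A ⊗ ℂ^B = ℂ^(A × B)` of two finite-dimensional Hilbert
spaces (one for each party), i.e. an unnormalised bipartite pure state. -/
structure BipartiteVector : Type 1 where
  A : Type
  B : Type
  [fintypeA : Fintype A]
  [decEqA : DecidableEq A]
  [fintypeB : Fintype B]
  [decEqB : DecidableEq B]
  vec : A × B → ℂ

attribute [instance] BipartiteVector.fintypeA BipartiteVector.decEqA
  BipartiteVector.fintypeB BipartiteVector.decEqB

/-! ### LOCC channels -/

/-- The local dimensions and the classical register of a bipartite state space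
`B(ℂ^A) ⊗ B(ℂ^B) ⊗ Diag(ℂ^X)`. -/
structure StateSpace : Type 1 where
  A : Type
  B : Type
  X : Type
  [fintypeA : Fintype A]
  [decEqA : DecidableEq A]
  [fintypeB : Fintype B]
  [decEqB : DecidableEq B]
  [fintypeX : Fintype X]
  [decEqX : DecidableEq X]

attribute [instance] StateSpace.fintypeA StateSpace.decEqA StateSpace.fintypeB
  StateSpace.decEqB StateSpace.fintypeX StateSpace.decEqX

namespace StateSpace

/-- Operators on `ℂ^A ⊗ ℂ^B ⊗ ℂ^X`. The channels below map operators that are diagonal in the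
register to operators that are diagonal in the register. -/
abbrev Op (S : StateSpace) : Type := Matrix ((S.A × S.B) × S.X) ((S.A × S.B) × S.X) ℂ

/-- Change the system of the first party and the register. -/
abbrev withFst (S : StateSpace) (A' Y : Type) [Fintype A'] [DecidableEq A'] [Fintype Y]
    [DecidableEq Y] : StateSpace := ⟨A', S.B, Y⟩

/-- Change the system of the second party and the register. -/
abbrev withSnd (S : StateSpace) (B' Y : Type) [Fintype B'] [DecidableEq B'] [Fintype Y]
    [DecidableEq Y] : StateSpace := ⟨S.A, B', Y⟩

end StateSpace

/-- `ρ ↦ ∑ j, (K_j ⊗ I ⊗ |g j⟩⟨f j|) ρ (K_j ⊗ I ⊗ |g j⟩⟨f j|)*`. -/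
noncomputable def fstMap (S : StateSpace) (A' Y : Type) [Fintype A'] [DecidableEq A']
    [Fintype Y] [DecidableEq Y] {J : Type} [Fintype J] (f : J → S.X) (g : J → Y)
    (K : J → Matrix A' S.A ℂ) (ρ : S.Op) : (S.withFst A' Y).Op :=
  ∑ j, ((K j ⊗ₖ (1 : Matrix S.B S.B ℂ)) ⊗ₖ Matrix.single (g j) (f j) (1 : ℂ)) * ρ *
    ((K j ⊗ₖ (1 : Matrix S.B S.B ℂ)) ⊗ₖ Matrix.single (g j) (f j) (1 : ℂ)).conjTranspose

/-- `ρ ↦ ∑ j, (I ⊗ K_j ⊗ |g j⟩⟨f j|) ρ (I ⊗ K_j ⊗ |g j⟩⟨f j|)*`. -/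
noncomputable def sndMap (S : StateSpace) (B' Y : Type) [Fintype B'] [DecidableEq B']
    [Fintype Y] [DecidableEq Y] {J : Type} [Fintype J] (f : J → S.X) (g : J → Y)
    (K : J → Matrix B' S.B ℂ) (ρ : S.Op) : (S.withSnd B' Y).Op :=
  ∑ j, (((1 : Matrix S.A S.A ℂ) ⊗ₖ K j) ⊗ₖ Matrix.single (g j) (f j) (1 : ℂ)) * ρ *
    (((1 : Matrix S.A S.A ℂ) ⊗ₖ K j) ⊗ₖ Matrix.single (g j) (f j) (1 : ℂ)).conjTranspose

/-- The (trace non-increasing) Kraus condition `∑ j, K_j* K_j ⊗ |f j⟩⟨f j| ≤ I`. -/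
def KrausCondition {H H' X J : Type} [Fintype H] [DecidableEq H] [Fintype H'] [Fintype X]
    [DecidableEq X] [Fintype J] (f : J → X) (K : J → Matrix H' H ℂ) : Prop :=
  (1 - ∑ j, ((K j).conjTranspose * K j) ⊗ₖ
    Matrix.single (f j) (f j) (1 : ℂ) : Matrix (H × X) (H × X) ℂ).PosSemidef

/-- One-step LOCC channels: one of the parties acts, conditioned on the register, and writes
to the register. -/
inductive IsOneStepLOCC : (S T : StateSpace) → (S.Op → T.Op) → Prop
  | fst (S : StateSpace) (A' Y : Type) [Fintype A'] [DecidableEq A'] [Fintype Y]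
      [DecidableEq Y] (J : Type) [Fintype J] (f : J → S.X) (g : J → Y)
      (K : J → Matrix A' S.A ℂ) (hK : KrausCondition f K) :
      IsOneStepLOCC S (S.withFst A' Y) (fstMap S A' Y f g K)
  | snd (S : StateSpace) (B' Y : Type) [Fintype B'] [DecidableEq B'] [Fintype Y]
      [DecidableEq Y] (J : Type) [Fintype J] (f : J → S.X) (g : J → Y)
      (K : J → Matrix B' S.B ℂ) (hK : KrausCondition f K) :
      IsOneStepLOCC S (S.withSnd B' Y) (sndMap S B' Y f g K)

/-- LOCC channels: compositions of finitely many one-step LOCC channels. -/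
inductive IsLOCC : (S T : StateSpace) → (S.Op → T.Op) → Prop
  | id (S : StateSpace) : IsLOCC S S (fun ρ => ρ)
  | step {S T R : StateSpace} {Λ : S.Op → T.Op} {Γ : T.Op → R.Op} :
      IsLOCC S T Λ → IsOneStepLOCC T R Γ → IsLOCC S R (fun ρ => Γ (Λ ρ))

namespace BipartiteVector

/-- The operator `|φ⟩⟨φ|`. -/
def ketbra (φ : BipartiteVector) : Matrix (φ.A × φ.B) (φ.A × φ.B) ℂ :=
  Matrix.vecMulVec φ.vec (star φ.vec)

/-- The state space `B(ℂ^A) ⊗ B(ℂ^B)`, with a one-point register. -/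
abbrev space (φ : BipartiteVector) : StateSpace := ⟨φ.A, φ.B, Unit⟩

/-- The pure state `|φ⟩⟨φ|` as an element of the state space with a one-point register. -/
def state (φ : BipartiteVector) : φ.space.Op := φ.ketbra ⊗ₖ (1 : Matrix Unit Unit ℂ)

/-- LOCC convertibility of pure states: some LOCC channel maps `|φ⟩⟨φ|` to `|ψ⟩⟨ψ|`. -/
def ConvertsTo (φ ψ : BipartiteVector) : Prop :=
  ∃ Λ : φ.space.Op → ψ.space.Op, IsLOCC φ.space ψ.space Λ ∧ Λ φ.state = ψ.state

end BipartiteVector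

/-! ### Local unitary equivalence -/

/-- `U` is (the matrix of) a partial isometry. -/
def IsPartialIsometry {H H' : Type} [Fintype H] [Fintype H'] (U : Matrix H' H ℂ) : Prop :=
  U * U.conjTranspose * U = U

namespace BipartiteVector

/-- Local unitary equivalence. -/
def LUEquiv (φ ψ : BipartiteVector) : Prop :=
  ∃ (U : Matrix ψ.A φ.A ℂ) (V : Matrix ψ.B φ.B ℂ),
    IsPartialIsometry U ∧ IsPartialIsometry V ∧
    ψ.vec = (U ⊗ₖ V).mulVec φ.vec ∧
    φ.vec = (U.conjTranspose ⊗ₖ V.conjTranspose).mulVec ψ.vec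

/-- The coefficient matrix of a vector. -/
def coeff (φ : BipartiteVector) : Matrix φ.A φ.B ℂ := Matrix.of fun a b => φ.vec (a, b)

theorem kronecker_mulVec {A B A' B' : Type} [Fintype A] [Fintype B]
    (U : Matrix A' A ℂ) (V : Matrix B' B ℂ) (v : A × B → ℂ) (a : A') (b : B') :
    (U ⊗ₖ V).mulVec v (a, b) = (U * (Matrix.of fun a b => v (a, b)) * V.transpose) a b := by
  simp only [Matrix.mulVec, dotProduct, Matrix.mul_apply, Matrix.kroneckerMap_apply,
    Fintype.sum_prod_type, Matrix.of_apply, Matrix.transpose_apply, Finset.sum_mul]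
  rw [Finset.sum_comm]
  exact Finset.sum_congr rfl fun _ _ => Finset.sum_congr rfl fun _ _ => by ring

theorem luEquiv_iff {φ ψ : BipartiteVector} : LUEquiv φ ψ ↔
    ∃ (U : Matrix ψ.A φ.A ℂ) (V : Matrix ψ.B φ.B ℂ),
      IsPartialIsometry U ∧ IsPartialIsometry V ∧
      ψ.coeff = U * φ.coeff * V.transpose ∧
      φ.coeff = U.conjTranspose * ψ.coeff * V.conjTranspose.transpose := by
  refine exists_congr fun U => exists_congr fun V => and_congr_right fun _ =>
    and_congr_right fun _ => and_congr ⟨fun h => ?_, fun h => ?_⟩ ⟨fun h => ?_, fun h => ?_⟩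
  · ext a b
    exact (congrFun h (a, b)).trans (kronecker_mulVec _ _ _ a b)
  · ext ⟨a, b⟩
    exact (congrFun (congrFun h a) b).trans (kronecker_mulVec _ _ _ a b).symm
  · ext a b
    exact (congrFun h (a, b)).trans (kronecker_mulVec _ _ _ a b)
  · ext ⟨a, b⟩
    exact (congrFun (congrFun h a) b).trans (kronecker_mulVec _ _ _ a b).symm

theorem isPartialIsometry_conjTranspose {H H' : Type} [Fintype H] [Fintype H']
    {U : Matrix H' H ℂ} (hU : IsPartialIsometry U) : IsPartialIsometry U.conjTranspose := by
  have := congrArg Matrix.conjTranspose hU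
  simpa [IsPartialIsometry, Matrix.mul_assoc] using this

/-- The orthogonal projection onto the column space of a matrix. -/
theorem exists_rangeProjection {A B : Type} [Fintype A] [DecidableEq A] [Fintype B]
    (M : Matrix A B ℂ) : ∃ P : Matrix A A ℂ, P.conjTranspose = P ∧ P * P = P ∧ P * M = M ∧
      ∀ Z : Matrix A A ℂ, Z * M = M → Z * P = P := by
  have hH : IsSelfAdjoint (M * M.conjTranspose) := Matrix.isHermitian_mul_conjTranspose_self M
  have hc : ∀ g : ℝ → ℝ, ContinuousOn g (spectrum ℝ (M * M.conjTranspose)) := fun g =>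
    (Matrix.finite_real_spectrum (A := M * M.conjTranspose)).continuousOn g
  set H := M * M.conjTranspose with hHdef
  have key : ∀ g : ℝ → ℝ, H * cfc g H = cfc (fun x => x * g x) H := fun g => by
    conv_lhs => rw [← cfc_id ℝ H hH]
    rw [cfc_id ℝ H hH, cfc_mul (fun x : ℝ => x) g H (hc _) (hc _), cfc_id' ℝ H hH]
  have hPH : cfc (fun x : ℝ => x * x⁻¹) H * H = H := by
    have h1 : cfc (fun x : ℝ => x * x⁻¹) H * cfc (fun x : ℝ => x) H
        = cfc (fun x : ℝ => x) H := by
      rw [← cfc_mul (fun x : ℝ => x * x⁻¹) (fun x => x) H (hc _) (hc _)]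
      congr 1
      funext x
      by_cases hx : x = 0 <;> simp [hx]
    rwa [cfc_id' ℝ H hH] at h1
  have hsa : (cfc (fun x : ℝ => x * x⁻¹) H).conjTranspose = cfc (fun x : ℝ => x * x⁻¹) H :=
    cfc_predicate (R := ℝ) (p := IsSelfAdjoint) (fun x : ℝ => x * x⁻¹) H
  refine ⟨cfc (fun x : ℝ => x * x⁻¹) H, hsa, ?_, ?_, fun Z hZ => ?_⟩
  · rw [← cfc_mul (fun x : ℝ => x * x⁻¹) (fun x : ℝ => x * x⁻¹) H (hc _) (hc _)]
    congr 1
    funext x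
    by_cases hx : x = 0 <;> simp [hx]
  · have h0 : (cfc (fun x : ℝ => x * x⁻¹) H * M - M) *
        (cfc (fun x : ℝ => x * x⁻¹) H * M - M).conjTranspose = 0 := by
      rw [Matrix.conjTranspose_sub, Matrix.conjTranspose_mul, hsa]
      have e : ∀ P : Matrix A A ℂ, (P * M - M) * (M.conjTranspose * P - M.conjTranspose)
          = (P * H - H) * P - (P * H - H) := fun P => by
        simp only [hHdef, Matrix.mul_sub, Matrix.sub_mul, Matrix.mul_assoc]
      rw [e, hPH]; simp
    exact sub_eq_zero.mp (Matrix.self_mul_conjTranspose_eq_zero.mp h0)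
  · rw [← key, ← Matrix.mul_assoc, hHdef, ← Matrix.mul_assoc, hZ]

theorem luEquiv_refl (φ : BipartiteVector) : LUEquiv φ φ :=
  luEquiv_iff.mpr ⟨1, 1, by simp [IsPartialIsometry], by simp [IsPartialIsometry],
    by simp, by simp⟩

theorem luEquiv_symm {φ ψ : BipartiteVector} (h : LUEquiv φ ψ) : LUEquiv ψ φ := by
  obtain ⟨U, V, hU, hV, h1, h2⟩ := h
  exact ⟨U.conjTranspose, V.conjTranspose, isPartialIsometry_conjTranspose hU,
    isPartialIsometry_conjTranspose hV, h2, by simpa using h1⟩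

/-- The one-sided part of transitivity. -/
theorem exists_comp {A A' A'' B B' : Type} [Fintype A] [DecidableEq A] [Fintype A']
    [Fintype A''] [Fintype B] [Fintype B'] {M : Matrix A B ℂ} {N : Matrix A' B' ℂ}
    {U : Matrix A' A ℂ} {U' : Matrix A'' A' ℂ} {V : Matrix B B' ℂ} {V' : Matrix B' B ℂ}
    (h1 : N = U * M * V)
    (hE : U.conjTranspose * U * M = M) (hF : M * (V * V') = M)
    (hE' : U'.conjTranspose * U' * N = N) :
    ∃ W : Matrix A'' A ℂ, IsPartialIsometry W ∧ W * M = U' * U * M ∧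
      ∃ P : Matrix A A ℂ, P * M = M ∧ W.conjTranspose = P * U.conjTranspose * U'.conjTranspose := by
  obtain ⟨P, hP1, hP2, hP3, hP4⟩ := exists_rangeProjection M
  have hUM : U * M = N * V' := by
    rw [h1, Matrix.mul_assoc, Matrix.mul_assoc U M, ← Matrix.mul_assoc M, Matrix.mul_assoc M, hF]
  have hfix : (U' * U).conjTranspose * (U' * U) * M = M := by
    calc (U' * U).conjTranspose * (U' * U) * M
        = U.conjTranspose * (U'.conjTranspose * U' * (U * M)) := by
          simp [Matrix.conjTranspose_mul, Matrix.mul_assoc]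
      _ = U.conjTranspose * (U * M) := by
          rw [hUM, ← Matrix.mul_assoc (U'.conjTranspose * U') N V', hE']
      _ = M := by rw [← Matrix.mul_assoc, hE]
  have hWP := hP4 _ hfix
  refine ⟨U' * U * P, ?_, by rw [Matrix.mul_assoc, hP3], P, hP3, ?_⟩
  · unfold IsPartialIsometry
    calc U' * U * P * (U' * U * P).conjTranspose * (U' * U * P)
        = U' * U * (P * P) * ((U' * U).conjTranspose * (U' * U) * P) := by
          rw [Matrix.conjTranspose_mul, hP1]; simp only [Matrix.mul_assoc]
      _ = U' * U * P := by rw [hWP, hP2, Matrix.mul_assoc, hP2]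
  · rw [Matrix.conjTranspose_mul, Matrix.conjTranspose_mul, hP1, Matrix.mul_assoc]

theorem fix_left {A A' B B' : Type} [Fintype A] [Fintype A'] [Fintype B']
    {U : Matrix A' A ℂ} (hU : IsPartialIsometry U) {M : Matrix A B ℂ} {N : Matrix A' B' ℂ}
    {V : Matrix B' B ℂ} (h : M = U.conjTranspose * N * V) : U.conjTranspose * U * M = M := by
  have h' : U.conjTranspose * U * U.conjTranspose = U.conjTranspose := by
    simpa [IsPartialIsometry] using isPartialIsometry_conjTranspose hU
  rw [h, ← Matrix.mul_assoc, ← Matrix.mul_assoc, h']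

theorem luEquiv_trans {φ ψ χ : BipartiteVector} (h : LUEquiv φ ψ) (h' : LUEquiv ψ χ) :
    LUEquiv φ χ := by
  rw [luEquiv_iff] at h h' ⊢
  obtain ⟨U, V, hU, hV, h1, h2⟩ := h
  obtain ⟨U', V', hU', hV', h1', h2'⟩ := h'
  have t1 : ψ.coeff.transpose = V * φ.coeff.transpose * U.transpose := by
    rw [h1]; simp [Matrix.transpose_mul, Matrix.mul_assoc]
  have t2 : φ.coeff.transpose =
      V.conjTranspose * ψ.coeff.transpose * U.conjTranspose.transpose := by
    rw [h2]; simp [Matrix.transpose_mul, Matrix.mul_assoc]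
  have t2' : ψ.coeff.transpose =
      V'.conjTranspose * χ.coeff.transpose * U'.conjTranspose.transpose := by
    rw [h2']; simp [Matrix.transpose_mul, Matrix.mul_assoc]
  have e1 := fix_left hU h2
  have e2 := fix_left hV t2
  have f1 : φ.coeff * (V.transpose * V.conjTranspose.transpose) = φ.coeff := by
    have := congrArg Matrix.transpose e2
    simpa [Matrix.transpose_mul] using this
  have f2 : φ.coeff.transpose * (U.transpose * U.conjTranspose.transpose) =
      φ.coeff.transpose := by
    have := congrArg Matrix.transpose e1
    simpa [Matrix.transpose_mul] using this
  obtain ⟨W, hW, hWM, P, hP, hWP⟩ := exists_comp h1 e1 f1 (fix_left hU' h2')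
  obtain ⟨X, hX, hXM, Q, hQ, hXQ⟩ := exists_comp t1 e2 f2 (fix_left hV' t2')
  have hXM' : φ.coeff * X.transpose = φ.coeff * V.transpose * V'.transpose := by
    have := congrArg Matrix.transpose hXM
    simpa [Matrix.transpose_mul, Matrix.mul_assoc] using this
  have hQ' : φ.coeff * Q.transpose = φ.coeff := by
    have := congrArg Matrix.transpose hQ
    simpa [Matrix.transpose_mul] using this
  refine ⟨W, X, hW, hX, ?_, ?_⟩
  · rw [hWM, Matrix.mul_assoc, hXM', h1', h1]
    simp only [Matrix.mul_assoc]
  · rw [hWP, hXQ, Matrix.transpose_mul, Matrix.transpose_mul]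
    symm
    calc P * U.conjTranspose * U'.conjTranspose * χ.coeff *
          (V'.conjTranspose.transpose * (V.conjTranspose.transpose * Q.transpose))
        = P * (U.conjTranspose * (U'.conjTranspose * χ.coeff * V'.conjTranspose.transpose) *
          V.conjTranspose.transpose) * Q.transpose := by simp only [Matrix.mul_assoc]
      _ = φ.coeff := by rw [← h2', ← h2, hP, hQ']

instance setoid : Setoid BipartiteVector where
  r := LUEquiv
  iseqv := ⟨luEquiv_refl, luEquiv_symm, luEquiv_trans⟩

/-! ### Direct sum and tensor product -/

/-- The zero vector of `ℂ ⊗ ℂ`. -/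
def zero : BipartiteVector := ⟨Unit, Unit, 0⟩

/-- The vector `|00⟩` of `ℂ ⊗ ℂ`. -/
def one : BipartiteVector := ⟨Unit, Unit, 1⟩

/-- The direct sum `φ ⊕ ψ` in `(ℂ^A ⊕ ℂ^A') ⊗ (ℂ^B ⊕ ℂ^B')`. -/
def directSum (φ ψ : BipartiteVector) : BipartiteVector :=
  ⟨φ.A ⊕ ψ.A, φ.B ⊕ ψ.B, fun
    | (Sum.inl a, Sum.inl b) => φ.vec (a, b)
    | (Sum.inr a, Sum.inr b) => ψ.vec (a, b)
    | _ => 0⟩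

/-- The tensor product `φ ⊗ ψ` in `(ℂ^A ⊗ ℂ^A') ⊗ (ℂ^B ⊗ ℂ^B')`. -/
def tensor (φ ψ : BipartiteVector) : BipartiteVector :=
  ⟨φ.A × ψ.A, φ.B × ψ.B, fun x => φ.vec (x.1.1, x.2.1) * ψ.vec (x.1.2, x.2.2)⟩

theorem coeff_directSum (φ ψ : BipartiteVector) :
    (directSum φ ψ).coeff = Matrix.fromBlocks φ.coeff 0 0 ψ.coeff := by
  ext a b
  rcases a with a | a <;> rcases b with b | b <;> rfl

theorem coeff_tensor (φ ψ : BipartiteVector) :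
    (tensor φ ψ).coeff = φ.coeff ⊗ₖ ψ.coeff := rfl

/-- Local unitary equivalence of coefficient matrices. -/
def CoeffEquiv {A B A' B' : Type} [Fintype A] [Fintype B] [Fintype A'] [Fintype B']
    (M : Matrix A B ℂ) (N : Matrix A' B' ℂ) : Prop :=
  ∃ (U : Matrix A' A ℂ) (V : Matrix B' B ℂ), IsPartialIsometry U ∧ IsPartialIsometry V ∧
    N = U * M * V.transpose ∧ M = U.conjTranspose * N * V.conjTranspose.transpose

section CoeffEquiv

variable {A B A' B' C D C' D' : Type} [Fintype A] [Fintype B] [Fintype A'] [Fintype B']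
  [Fintype C] [Fintype D] [Fintype C'] [Fintype D']

theorem coeffEquiv_fromBlocks {M : Matrix A B ℂ} {M' : Matrix A' B' ℂ} {N : Matrix C D ℂ}
    {N' : Matrix C' D' ℂ} (h : CoeffEquiv M M') (h' : CoeffEquiv N N') :
    CoeffEquiv (Matrix.fromBlocks M 0 0 N) (Matrix.fromBlocks M' 0 0 N') := by
  obtain ⟨U, V, hU, hV, h1, h2⟩ := h
  obtain ⟨U', V', hU', hV', h1', h2'⟩ := h'
  unfold IsPartialIsometry at hU hV hU' hV'
  refine ⟨Matrix.fromBlocks U 0 0 U', Matrix.fromBlocks V 0 0 V', ?_, ?_, ?_, ?_⟩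
  · simp [IsPartialIsometry, Matrix.fromBlocks_conjTranspose, Matrix.fromBlocks_multiply, hU, hU']
  · simp [IsPartialIsometry, Matrix.fromBlocks_conjTranspose, Matrix.fromBlocks_multiply, hV, hV']
  · simp only [Matrix.fromBlocks_transpose, Matrix.fromBlocks_multiply, Matrix.mul_zero,
      Matrix.zero_mul, add_zero, zero_add, Matrix.transpose_zero, ← h1, ← h1']
  · simp only [Matrix.fromBlocks_transpose, Matrix.fromBlocks_conjTranspose,
      Matrix.fromBlocks_multiply, Matrix.mul_zero, Matrix.zero_mul, add_zero, zero_add,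
      Matrix.transpose_zero, Matrix.conjTranspose_zero, ← h2, ← h2']

theorem coeffEquiv_kronecker {M : Matrix A B ℂ} {M' : Matrix A' B' ℂ} {N : Matrix C D ℂ}
    {N' : Matrix C' D' ℂ} (h : CoeffEquiv M M') (h' : CoeffEquiv N N') :
    CoeffEquiv (M ⊗ₖ N) (M' ⊗ₖ N') := by
  obtain ⟨U, V, hU, hV, h1, h2⟩ := h
  obtain ⟨U', V', hU', hV', h1', h2'⟩ := h'
  unfold IsPartialIsometry at hU hV hU' hV'
  refine ⟨U ⊗ₖ U', V ⊗ₖ V', ?_, ?_, ?_, ?_⟩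
  · simp only [IsPartialIsometry, Matrix.conjTranspose_kronecker, ← Matrix.mul_kronecker_mul,
      hU, hU']
  · simp only [IsPartialIsometry, Matrix.conjTranspose_kronecker, ← Matrix.mul_kronecker_mul,
      hV, hV']
  · conv_lhs => rw [h1, h1', Matrix.mul_kronecker_mul, Matrix.mul_kronecker_mul]
    rfl
  · conv_lhs => rw [h2, h2', Matrix.mul_kronecker_mul, Matrix.mul_kronecker_mul]
    rw [Matrix.conjTranspose_kronecker, Matrix.conjTranspose_kronecker]
    rfl

theorem coeffEquiv_of_equiv [DecidableEq A] [DecidableEq B] {M : Matrix A B ℂ}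
    {N : Matrix A' B' ℂ} (e : A ≃ A') (e' : B ≃ B') (h : ∀ a b, N (e a) (e' b) = M a b) :
    CoeffEquiv M N := by
  have hp : ∀ {X X' : Type} [Fintype X] [Fintype X'] [DecidableEq X] (k : X ≃ X'),
      ((1 : Matrix X X ℂ).submatrix k.symm id).conjTranspose *
        (1 : Matrix X X ℂ).submatrix k.symm id = 1 := fun k => by
    rw [Matrix.conjTranspose_submatrix, Matrix.submatrix_mul_equiv]
    simp
  have hN : N = M.submatrix e.symm e'.symm := by
    ext x y
    simp [← h]
  refine ⟨(1 : Matrix A A ℂ).submatrix e.symm id, (1 : Matrix B B ℂ).submatrix e'.symm id,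
    ?_, ?_, ?_, ?_⟩
  · rw [IsPartialIsometry, Matrix.mul_assoc, hp, Matrix.mul_one]
  · rw [IsPartialIsometry, Matrix.mul_assoc, hp, Matrix.mul_one]
  · rw [hN]
    ext x y
    simp [Matrix.mul_apply, Matrix.one_apply]
  · have hM : N = (1 : Matrix A A ℂ).submatrix e.symm id * M *
        ((1 : Matrix B B ℂ).submatrix e'.symm id).transpose := by
      rw [hN]
      ext x y
      simp [Matrix.mul_apply, Matrix.one_apply]
    have ht := congrArg Matrix.transpose (hp e')
    rw [Matrix.transpose_mul, Matrix.transpose_one] at ht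
    rw [hM, Matrix.mul_assoc, Matrix.mul_assoc, ht, Matrix.mul_one, ← Matrix.mul_assoc, hp,
      Matrix.one_mul]

theorem coeffEquiv_fromBlocks_zero [DecidableEq A] [DecidableEq B] (M : Matrix A B ℂ) :
    CoeffEquiv (Matrix.fromBlocks (0 : Matrix C D ℂ) 0 0 M) M := by
  have hp : ∀ (X Y : Type) [Fintype X] [DecidableEq X] [Fintype Y],
      IsPartialIsometry (Matrix.fromCols (0 : Matrix X Y ℂ) (1 : Matrix X X ℂ)) :=
    fun X Y => by
      simp [IsPartialIsometry, Matrix.conjTranspose_fromCols_eq_fromRows_conjTranspose,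
        Matrix.fromCols_mul_fromRows]
  refine ⟨Matrix.fromCols (0 : Matrix A C ℂ) 1, Matrix.fromCols (0 : Matrix B D ℂ) 1,
    hp _ _, hp _ _, ?_, ?_⟩
  · simp [Matrix.transpose_fromCols, Matrix.fromCols_mul_fromBlocks,
      Matrix.fromCols_mul_fromRows]
  · simp [Matrix.conjTranspose_fromCols_eq_fromRows_conjTranspose, Matrix.transpose_fromRows,
      Matrix.fromRows_mul, Matrix.mul_fromCols]
    ext (i | i) (j | j) <;> simp

end CoeffEquiv

theorem directSum_congr {φ φ' ψ ψ' : BipartiteVector} (h : LUEquiv φ φ') (h' : LUEquiv ψ ψ') :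
    LUEquiv (directSum φ ψ) (directSum φ' ψ') := by
  have := coeffEquiv_fromBlocks (luEquiv_iff.mp h) (luEquiv_iff.mp h')
  rw [← coeff_directSum, ← coeff_directSum] at this
  exact luEquiv_iff.mpr this

theorem tensor_congr {φ φ' ψ ψ' : BipartiteVector} (h : LUEquiv φ φ') (h' : LUEquiv ψ ψ') :
    LUEquiv (tensor φ ψ) (tensor φ' ψ') :=
  luEquiv_iff.mpr (coeffEquiv_kronecker (luEquiv_iff.mp h) (luEquiv_iff.mp h'))

/-- Relabelling the basis vectors gives an equivalent vector. -/
theorem luEquiv_of_equiv {φ ψ : BipartiteVector} (e : φ.A ≃ ψ.A) (e' : φ.B ≃ ψ.B)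
    (h : ∀ a b, ψ.vec (e a, e' b) = φ.vec (a, b)) : LUEquiv φ ψ :=
  luEquiv_iff.mpr (coeffEquiv_of_equiv (M := φ.coeff) (N := ψ.coeff) e e' h)

theorem luEquiv_of_zero {φ ψ : BipartiteVector} (h : φ.vec = 0) (h' : ψ.vec = 0) :
    LUEquiv φ ψ :=
  ⟨0, 0, by simp [IsPartialIsometry], by simp [IsPartialIsometry], by simp [h'], by simp [h]⟩

theorem zero_directSum (φ : BipartiteVector) : LUEquiv (directSum zero φ) φ := by
  have := coeffEquiv_fromBlocks_zero (C := Unit) (D := Unit) φ.coeff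
  have h0 : (0 : Matrix Unit Unit ℂ) = zero.coeff := rfl
  rw [h0] at this
  refine luEquiv_iff.mpr ?_
  rw [coeff_directSum]
  exact this

end BipartiteVector

/-- The set `𝒮₂` of local unitary equivalence classes of unnormalised bipartite pure states. -/
def S2 : Type 1 := Quotient BipartiteVector.setoid

namespace S2

open BipartiteVector

/-- The class of a vector. -/
def mk (φ : BipartiteVector) : S2 := Quotient.mk _ φ

noncomputable instance : Zero S2 := ⟨mk zero⟩
noncomputable instance : One S2 := ⟨mk one⟩
noncomputable instance : Add S2 :=
  ⟨Quotient.map₂ directSum fun _ _ h _ _ h' => directSum_congr h h'⟩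
noncomputable instance : Mul S2 :=
  ⟨Quotient.map₂ tensor fun _ _ h _ _ h' => tensor_congr h h'⟩

theorem mk_add (φ ψ : BipartiteVector) : mk φ + mk ψ = mk (directSum φ ψ) := rfl
theorem mk_mul (φ ψ : BipartiteVector) : mk φ * mk ψ = mk (tensor φ ψ) := rfl

protected theorem add_comm' (a b : S2) : a + b = b + a := by
  induction a, b using Quotient.inductionOn₂ with | h φ ψ => ?_
  refine Quotient.sound (luEquiv_of_equiv (Equiv.sumComm _ _) (Equiv.sumComm _ _) ?_)
  rintro (a | a) (b | b) <;> rfl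

protected theorem mul_comm' (a b : S2) : a * b = b * a := by
  induction a, b using Quotient.inductionOn₂ with | h φ ψ => ?_
  refine Quotient.sound (luEquiv_of_equiv (Equiv.prodComm _ _) (Equiv.prodComm _ _) ?_)
  rintro ⟨a, a'⟩ ⟨b, b'⟩
  exact mul_comm _ _

protected theorem zero_add' (a : S2) : 0 + a = a := by
  induction a using Quotient.inductionOn with | h φ => ?_
  exact Quotient.sound (zero_directSum φ)

protected theorem one_mul' (a : S2) : 1 * a = a := by
  induction a using Quotient.inductionOn with | h φ => ?_
  refine Quotient.sound (luEquiv_of_equiv (Equiv.punitProd _) (Equiv.punitProd _) ?_)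
  rintro ⟨a, a'⟩ ⟨b, b'⟩
  exact (one_mul _).symm

protected theorem zero_mul' (a : S2) : 0 * a = 0 := by
  induction a using Quotient.inductionOn with | h φ => ?_
  exact Quotient.sound (luEquiv_of_zero (funext fun _ => zero_mul _) rfl)

protected theorem left_distrib' (a b c : S2) : a * (b + c) = a * b + a * c := by
  induction a, b, c using Quotient.inductionOn₃ with | h φ ψ χ => ?_
  refine Quotient.sound (luEquiv_of_equiv (Equiv.prodSumDistrib _ _ _)
    (Equiv.prodSumDistrib _ _ _) ?_)
  rintro ⟨a, a' | a'⟩ ⟨b, b' | b'⟩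
  · rfl
  · exact (mul_zero _).symm
  · exact (mul_zero _).symm
  · rfl

/-- The semiring of local unitary equivalence classes, with direct sum and tensor product. -/
noncomputable instance : CommSemiring S2 where
  add_assoc a b c := by
    induction a, b, c using Quotient.inductionOn₃ with | h φ ψ χ => ?_
    refine Quotient.sound (luEquiv_of_equiv (Equiv.sumAssoc _ _ _) (Equiv.sumAssoc _ _ _) ?_)
    rintro ((a | a) | a) ((b | b) | b) <;> rfl
  zero_add := S2.zero_add'
  add_zero a := by rw [S2.add_comm', S2.zero_add']
  add_comm := S2.add_comm'
  mul_assoc a b c := by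
    induction a, b, c using Quotient.inductionOn₃ with | h φ ψ χ => ?_
    refine Quotient.sound (luEquiv_of_equiv (Equiv.prodAssoc _ _ _) (Equiv.prodAssoc _ _ _) ?_)
    rintro ⟨⟨a, a'⟩, a''⟩ ⟨⟨b, b'⟩, b''⟩
    exact (mul_assoc _ _ _).symm
  one_mul := S2.one_mul'
  mul_one a := by rw [S2.mul_comm', S2.one_mul']
  mul_comm := S2.mul_comm'
  zero_mul := S2.zero_mul'
  mul_zero a := by rw [S2.mul_comm', S2.zero_mul']
  left_distrib := S2.left_distrib'
  right_distrib a b c := by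
    rw [S2.mul_comm', S2.left_distrib', S2.mul_comm' c a, S2.mul_comm' c b]
  nsmul := nsmulRec

end S2

/-! ### The preorder given by LOCC convertibility -/

namespace BipartiteVector

theorem convertsTo_refl (φ : BipartiteVector) : ConvertsTo φ φ := ⟨_, IsLOCC.id _, rfl⟩

theorem isLOCC_comp {S T R : StateSpace} {Λ : S.Op → T.Op} {Γ : T.Op → R.Op}
    (h : IsLOCC S T Λ) (h' : IsLOCC T R Γ) : IsLOCC S R (fun ρ => Γ (Λ ρ)) := by
  induction h' with
  | id => exact h
  | step _ h2 ih => exact IsLOCC.step ih h2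

theorem convertsTo_trans {φ ψ χ : BipartiteVector} (h : ConvertsTo φ ψ) (h' : ConvertsTo ψ χ) :
    ConvertsTo φ χ := by
  obtain ⟨Λ, hΛ, e⟩ := h
  obtain ⟨Γ, hΓ, e'⟩ := h'
  exact ⟨_, isLOCC_comp hΛ hΓ, by rw [e, e']⟩

theorem krausCondition_of_isPartialIsometry {H H' : Type} [Fintype H] [DecidableEq H]
    [Fintype H'] {U : Matrix H' H ℂ} (hU : IsPartialIsometry U) :
    KrausCondition (fun _ : Unit => ()) (fun _ : Unit => U) := by
  have h1 : U.conjTranspose * U * (U.conjTranspose * U) = U.conjTranspose * U := by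
    rw [Matrix.mul_assoc, ← Matrix.mul_assoc U, hU]
  have hs : Matrix.single () () (1 : ℂ) = 1 := by ext; simp
  have h2 : (1 - (U.conjTranspose * U) ⊗ₖ (1 : Matrix Unit Unit ℂ) :
      Matrix (H × Unit) (H × Unit) ℂ) =
      (1 - (U.conjTranspose * U) ⊗ₖ (1 : Matrix Unit Unit ℂ)).conjTranspose *
        (1 - (U.conjTranspose * U) ⊗ₖ (1 : Matrix Unit Unit ℂ)) := by
    simp [Matrix.conjTranspose_kronecker, Matrix.mul_sub, Matrix.sub_mul,
      ← Matrix.mul_kronecker_mul, h1]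
  unfold KrausCondition
  simp only [Finset.univ_unique, Finset.sum_singleton, hs]
  rw [h2]
  exact Matrix.posSemidef_conjTranspose_mul_self _

theorem conj_vecMulVec {m n : Type} [Fintype n] (W : Matrix m n ℂ) (v : n → ℂ) :
    W * Matrix.vecMulVec v (star v) * W.conjTranspose =
      Matrix.vecMulVec (W.mulVec v) (star (W.mulVec v)) := by
  rw [Matrix.mul_vecMulVec, Matrix.vecMulVec_mul, Matrix.star_mulVec]

theorem convertsTo_of_luEquiv {φ ψ : BipartiteVector} (h : LUEquiv φ ψ) : ConvertsTo φ ψ := by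
  obtain ⟨U, V, hU, hV, h1, -⟩ := h
  have hs : Matrix.single () () (1 : ℂ) = 1 := by ext; simp
  refine ⟨_, IsLOCC.step (IsLOCC.step (IsLOCC.id _)
    (IsOneStepLOCC.fst φ.space ψ.A Unit Unit (fun _ => ()) (fun _ => ()) (fun _ => U)
      (krausCondition_of_isPartialIsometry hU)))
    (IsOneStepLOCC.snd (φ.space.withFst ψ.A Unit) ψ.B Unit Unit (fun _ => ()) (fun _ => ())
      (fun _ => V) (krausCondition_of_isPartialIsometry hV)), ?_⟩
  simp only [fstMap, sndMap, state, ketbra, Finset.univ_unique, Finset.sum_singleton, hs,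
    Matrix.conjTranspose_kronecker, Matrix.conjTranspose_one, ← Matrix.mul_kronecker_mul,
    Matrix.mul_one]
  congr 1
  have hk := conj_vecMulVec (U ⊗ₖ V) φ.vec
  rw [← h1] at hk
  rw [← hk]
  have e : (U ⊗ₖ V : Matrix (ψ.A × ψ.B) (φ.A × φ.B) ℂ) =
      ((1 : Matrix ψ.A ψ.A ℂ) ⊗ₖ V) * (U ⊗ₖ (1 : Matrix φ.B φ.B ℂ)) := by
    rw [← Matrix.mul_kronecker_mul, Matrix.one_mul, Matrix.mul_one]
  have e' := congrArg Matrix.conjTranspose e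
  simp only [Matrix.conjTranspose_mul, Matrix.conjTranspose_kronecker,
    Matrix.conjTranspose_one] at e'
  rw [Matrix.conjTranspose_kronecker, e', e]
  simp only [Matrix.mul_assoc]

end BipartiteVector

namespace S2

open BipartiteVector

/-- `[φ] ≤ [ψ]` iff `|ψ⟩` can be converted to `|φ⟩` by LOCC. -/
instance : Preorder S2 where
  le := Quotient.lift₂ (fun φ ψ => ConvertsTo ψ φ) fun _ _ _ _ h h' => propext
    ⟨fun k => convertsTo_trans (convertsTo_of_luEquiv (luEquiv_symm h'))
      (convertsTo_trans k (convertsTo_of_luEquiv h)),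
    fun k => convertsTo_trans (convertsTo_of_luEquiv h')
      (convertsTo_trans k (convertsTo_of_luEquiv (luEquiv_symm h)))⟩
  le_refl a := by
    induction a using Quotient.inductionOn with | h φ => ?_
    exact convertsTo_refl φ
  le_trans a b c := by
    induction a, b, c using Quotient.inductionOn₃ with | h φ ψ χ => ?_
    exact fun h h' => convertsTo_trans h' h

theorem mk_le_mk (φ ψ : BipartiteVector) : mk φ ≤ mk ψ ↔ ConvertsTo ψ φ := Iff.rfl

end S2

/-- The asymptotic LOCC spectrum `Δ(𝒮₂)`: the order preserving semiring homomorphisms from `𝒮₂`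
to the nonnegative reals. -/
def asymptoticSpectrum : Set (S2 →+* ℝ≥0) := {f | Monotone f}

/-! ### The functionals `f_α` -/

/-- The partial trace of the second system. -/
def partialTraceSnd {A B : Type} [Fintype B] (ρ : Matrix (A × B) (A × B) ℂ) : Matrix A A ℂ :=
  Matrix.of fun a a' => ∑ b, ρ (a, b) (a', b)

/-- The power `ρ^α` of a positive semidefinite matrix, through the functional calculus. The power
is taken on the support of `ρ`, so that `ρ^0` is the projection onto the support. -/
noncomputable def supportPow {A : Type} [Fintype A] [DecidableEq A] (α : ℝ) (ρ : Matrix A A ℂ) :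
    Matrix A A ℂ :=
  cfc (fun x : ℝ => if x = 0 then 0 else x ^ α) ρ

/-- `f_α(φ) = Tr [(Tr₂ |φ⟩⟨φ|)^α]`. -/
noncomputable def spectralFunctional (α : ℝ) (φ : BipartiteVector) : ℂ :=
  (supportPow α (partialTraceSnd φ.ketbra)).trace

/-- `φ = ∑ i, √(p_i) u_i ⊗ v_i` with all `p_i > 0` and with orthonormal families `u` and `v`, for
some `u` and `v`; that is, the `p_i` are the Schmidt coefficients of `φ`. -/
def IsSchmidtCoefficients (φ : BipartiteVector) {r : ℕ} (p : Fin r → ℝ) : Prop :=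
  (∀ i, 0 < p i) ∧
  ∃ (u : Fin r → EuclideanSpace ℂ φ.A) (v : Fin r → EuclideanSpace ℂ φ.B),
    Orthonormal ℂ u ∧ Orthonormal ℂ v ∧
    ∀ a b, φ.vec (a, b) = ∑ i, (Real.sqrt (p i) : ℂ) * u i a * v i b

/-! ### Power sums of squared singular values -/

/-! Let `M` be the coefficient matrix of a vector. Then `f_α` is the sum of the `α`-th powers of the
nonzero eigenvalues of `M Mᴴ`, that is, of the squared singular values of `M`. Singular value
decompositions of two matrices combine into one for their block sum and one for their Kronecker
product, so `f_α` is additive and multiplicative.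

Monotonicity for `0 < α ≤ 1` rests on the Schatten quasi-norm `f_α ^ (1/α)`. A one-step channel
turns a pure branch `M` into pure branches `N j` with `∑ j, N j (N j)ᴴ ≤ M Mᴴ` (after a
transposition if the first party acts), and the quasi-norm is superadditive on positive operators
(`sum_singularPowSum_rpow_inv_le`: concavity of `x ^ α` plus the reverse Minkowski inequality).
Hence the total quasi-norm of the branches never grows. If the final state is `|ψ⟩⟨ψ|` with `ψ ≠ 0`,
every branch is some `c i • ψ` with `∑ i, ‖c i‖² = 1` (`exists_smul_of_sum_vecMulVec_eq`), and
homogeneity makes the final total exactly the quasi-norm of `ψ`. The case `α = 0` is the limit `α →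
0+`.

Conversely, the Schmidt decomposition writes every class as a finite sum of classes of `√p |00⟩`, so
a homomorphism `f` is determined by `h p = f(√p |00⟩)`. This `h` is multiplicative, and it is
monotone because amplitudes can be damped locally; so `h p = p ^ α` with `α ≥ 0`
(`exists_rpow_of_monotone_of_map_mul`). Measuring `|00⟩ + |11⟩` on both sides leaves `√2 |00⟩`
(`maximallyEntangled_convertsTo`), whence `2 ^ α ≤ 2` and `α ≤ 1`. -/

/-- The power `x ^ α` with the value `0` at `x = 0`. -/
noncomputable def supportRpow (α x : ℝ) : ℝ := if x = 0 then 0 else x ^ α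

@[simp] theorem supportRpow_zero (α : ℝ) : supportRpow α 0 = 0 := if_pos rfl

theorem supportRpow_of_pos {α x : ℝ} (hx : 0 < x) : supportRpow α x = x ^ α := if_neg hx.ne'

theorem supportRpow_of_exponent_pos {α : ℝ} (hα : 0 < α) (x : ℝ) :
    supportRpow α x = x ^ α := by
  unfold supportRpow
  split_ifs with h
  · rw [h, Real.zero_rpow hα.ne']
  · rfl

theorem supportRpow_nonneg {α x : ℝ} (hx : 0 ≤ x) : 0 ≤ supportRpow α x := by
  unfold supportRpow
  split_ifs
  exacts [le_rfl, Real.rpow_nonneg hx α]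

theorem supportRpow_mul {α x y : ℝ} (hx : 0 ≤ x) (hy : 0 ≤ y) :
    supportRpow α (x * y) = supportRpow α x * supportRpow α y := by
  unfold supportRpow
  by_cases h : x = 0
  · simp [h]
  by_cases h' : y = 0
  · simp [h']
  simp [h, h', Real.mul_rpow hx hy]

/-! ### Spectra up to zeros, and the singular value decomposition -/

section SingularValues

variable {A B C ι : Type} [Fintype A] [DecidableEq A] [Fintype B]
  [Fintype C] [DecidableEq C] [Fintype ι] [DecidableEq ι]

/-- The sum of the `α`-th powers of the nonzero eigenvalues of `M Mᴴ`. -/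
noncomputable def singularPowSum {A B : Type} [Fintype A] [DecidableEq A] [Fintype B]
    (α : ℝ) (M : Matrix A B ℂ) : ℝ :=
  ∑ i, supportRpow α ((Matrix.isHermitian_mul_conjTranspose_self M).eigenvalues i)

/-- The factor `X ^ n` only adds roots at `0`, where `g` vanishes. This freedom allows matrices of
different sizes to be compared. -/
theorem sum_eigenvalues_eq_sum_roots {H : Matrix A A ℂ} (hH : H.IsHermitian) {g : ℝ → ℝ}
    (hg : g 0 = 0) (n : ℕ) :
    ∑ i, g (hH.eigenvalues i) =
      ((Polynomial.X ^ n * H.charpoly).roots.map fun z : ℂ => g z.re).sum := by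
  rw [Polynomial.roots_mul (mul_ne_zero (pow_ne_zero _ Polynomial.X_ne_zero)
    H.charpoly_monic.ne_zero), hH.roots_charpoly_eq_eigenvalues]
  simp [hg, Multiset.map_nsmul, Multiset.sum_nsmul]

/-- Shaped for `Matrix.charpoly_mul_comm'`: the characteristic polynomials of `X Y` and `Y X` agree
up to powers of the variable. -/
theorem sum_eigenvalues_congr {H : Matrix A A ℂ} (hH : H.IsHermitian) {K : Matrix C C ℂ}
    (hK : K.IsHermitian) {g : ℝ → ℝ} (hg : g 0 = 0) {m n : ℕ}
    (h : Polynomial.X ^ m * H.charpoly = Polynomial.X ^ n * K.charpoly) :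
    ∑ i, g (hH.eigenvalues i) = ∑ i, g (hK.eigenvalues i) := by
  rw [sum_eigenvalues_eq_sum_roots hH hg m, sum_eigenvalues_eq_sum_roots hK hg n, h]

theorem sum_eigenvalues_diagonal (d : ι → ℝ) (g : ℝ → ℝ) (hg : g 0 = 0)
    (hd : (Matrix.diagonal fun i => (d i : ℂ)).IsHermitian) :
    ∑ i, g (hd.eigenvalues i) = ∑ i, g (d i) := by
  rw [sum_eigenvalues_eq_sum_roots hd hg 0, Matrix.charpoly_diagonal, pow_zero, one_mul,
    Polynomial.roots_prod _ _ (by simp [Finset.prod_ne_zero_iff, Polynomial.X_sub_C_ne_zero])]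
  simp

/-- `M = W diag(√p) Vᵀ` with `W` and `V` isometries. -/
def IsSingularDecomp (M : Matrix A B ℂ) (p : ι → ℝ) : Prop :=
  (∀ i, 0 ≤ p i) ∧ ∃ (W : Matrix A ι ℂ) (V : Matrix B ι ℂ), W.conjTranspose * W = 1 ∧
    V.conjTranspose * V = 1 ∧
    M = W * Matrix.diagonal (fun i => ((Real.sqrt (p i) : ℝ) : ℂ)) * V.transpose

/-- Here `M Mᴴ = W diag(p) Wᴴ`; moving `W` cyclically and using `Wᴴ W = 1` leaves `diag(p)`, with
the same nonzero spectrum. In particular the power sum does not depend on the decomposition. -/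
theorem IsSingularDecomp.singularPowSum_eq {M : Matrix A B ℂ} {p : ι → ℝ}
    (h : IsSingularDecomp M p) (α : ℝ) : singularPowSum α M = ∑ i, supportRpow α (p i) := by
  obtain ⟨hp, W, V, hW, hV, hM⟩ := h
  have hV' : V.transpose * V.transpose.conjTranspose = 1 := by
    have := congrArg Matrix.transpose hV
    rwa [Matrix.transpose_mul, Matrix.transpose_one] at this
  set E : Matrix ι ι ℂ := Matrix.diagonal fun i => ((Real.sqrt (p i) : ℝ) : ℂ) with hE
  have hEE : E * E.conjTranspose = Matrix.diagonal fun i => (p i : ℂ) := by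
    rw [hE, Matrix.diagonal_conjTranspose, Matrix.diagonal_mul_diagonal]
    congr 1
    funext i
    simp [← Complex.ofReal_mul, Real.mul_self_sqrt (hp i)]
  have hMM : M * M.conjTranspose = W * ((Matrix.diagonal fun i => (p i : ℂ)) * W.conjTranspose) := by
    calc M * M.conjTranspose
        = W * E * (V.transpose * V.transpose.conjTranspose) * (E.conjTranspose * W.conjTranspose) := by
          rw [hM]; simp only [Matrix.conjTranspose_mul, Matrix.mul_assoc]
      _ = _ := by rw [hV', ← hEE]; simp only [Matrix.mul_assoc, Matrix.one_mul]
  have hd : (Matrix.diagonal fun i => (p i : ℂ)).IsHermitian := by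
    rw [← hEE]; exact Matrix.isHermitian_mul_conjTranspose_self E
  rw [singularPowSum, sum_eigenvalues_congr _ hd (supportRpow_zero α) (m := Fintype.card ι)
    (n := Fintype.card A), sum_eigenvalues_diagonal _ _ (supportRpow_zero α)]
  rw [hMM, Matrix.charpoly_mul_comm', Matrix.mul_assoc, hW, Matrix.mul_one]

/-- `M Mᴴ` and `Mᴴ M` have the same nonzero spectrum. This symmetry between the parties reduces
operations on the first system to operations on the second. -/
theorem singularPowSum_transpose [DecidableEq B] (α : ℝ) (M : Matrix A B ℂ) :
    singularPowSum α M.transpose = singularPowSum α M := by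
  refine sum_eigenvalues_congr _ _ (supportRpow_zero α) (m := Fintype.card A)
    (n := Fintype.card B) ?_
  have : M.transpose * M.transpose.conjTranspose = (M.conjTranspose * M).transpose := by
    rw [Matrix.transpose_mul]; rfl
  rw [this, Matrix.charpoly_transpose, ← Matrix.charpoly_mul_comm']

theorem eigenvalues_mul_conjTranspose_nonneg (M : Matrix A B ℂ) (i : A) :
    0 ≤ (Matrix.isHermitian_mul_conjTranspose_self M).eigenvalues i :=
  (Matrix.posSemidef_self_mul_conjTranspose M).eigenvalues_nonneg i

theorem singularPowSum_nonneg (α : ℝ) (M : Matrix A B ℂ) : 0 ≤ singularPowSum α M :=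
  Finset.sum_nonneg fun i _ => supportRpow_nonneg (eigenvalues_mul_conjTranspose_nonneg M i)

/-- The singular value decomposition. -/
theorem exists_isSingularDecomp (M : Matrix A B ℂ) :
    ∃ (r : ℕ) (p : Fin r → ℝ), (∀ i, 0 < p i) ∧ IsSingularDecomp M p := by
  have hH := Matrix.isHermitian_mul_conjTranspose_self M
  let U : Matrix A A ℂ := hH.eigenvectorUnitary
  let l := hH.eigenvalues
  have hU1 : U.conjTranspose * U = 1 := Unitary.coe_star_mul_self hH.eigenvectorUnitary
  have hU2 : U * U.conjTranspose = 1 := Unitary.coe_mul_star_self hH.eigenvectorUnitary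
  have hl : ∀ i, 0 ≤ l i := eigenvalues_mul_conjTranspose_nonneg M
  -- In an eigenbasis of `M Mᴴ` the rows of the matrix become orthogonal, with the eigenvalues as
  -- squared norms.
  have hS : (U.conjTranspose * M) * (U.conjTranspose * M).conjTranspose =
      Matrix.diagonal fun i => (l i : ℂ) := by
    have := hH.spectral_theorem
    rw [Unitary.conjStarAlgAut_apply] at this
    rw [Matrix.conjTranspose_mul, Matrix.conjTranspose_conjTranspose, Matrix.mul_assoc,
      ← Matrix.mul_assoc M, this]
    change U.conjTranspose * ((U * _ * U.conjTranspose) * U) = _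
    rw [Matrix.mul_assoc (U * _), hU1, Matrix.mul_one, ← Matrix.mul_assoc, hU1, Matrix.one_mul]
    rfl
  set N := U.conjTranspose * M with hN
  have hMN : M = U * N := by rw [hN, ← Matrix.mul_assoc, hU2, Matrix.one_mul]
  let I := {i : A // 0 < l i}
  let e : Fin (Fintype.card I) ≃ I := (Fintype.equivFin I).symm
  have hrow : ∀ i, l i = 0 → ∀ b, N i b = 0 := fun i hi b => by
    have h := congrFun (congrFun hS i) i
    rw [Matrix.diagonal_apply_eq, hi, Matrix.mul_apply] at h
    have h2 : ∑ b, Complex.normSq (N i b) = 0 := by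
      have : ((∑ b, Complex.normSq (N i b) : ℝ) : ℂ) = 0 := by
        rw [Complex.ofReal_sum, ← Complex.ofReal_zero, ← h]
        exact Finset.sum_congr rfl fun b _ => (Complex.mul_conj _).symm
      exact_mod_cast this
    exact Complex.normSq_eq_zero.mp
      ((Finset.sum_eq_zero_iff_of_nonneg fun b _ => Complex.normSq_nonneg _).mp h2 b
        (Finset.mem_univ b))
  have hsq : ∀ i : I, ((Real.sqrt (l i) : ℝ) : ℂ) ≠ 0 := fun i => by
    simpa using (Real.sqrt_pos.mpr i.2).ne'
  -- The left singular vectors are the eigenvectors with positive eigenvalue; the right ones are the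
  -- corresponding rows of `N`, normalised.
  refine ⟨Fintype.card I, fun i => l (e i), fun i => (e i).2, fun i => hl _,
    U.submatrix id (fun i => (e i : A)),
    Matrix.of fun b i => N (e i) b / (Real.sqrt (l (e i)) : ℝ), ?_, ?_, ?_⟩
  · ext i j
    have := congrFun (congrFun hU1 (e i)) (e j)
    simpa [Matrix.mul_apply, Matrix.one_apply, Subtype.ext_iff.symm] using this
  · ext i j
    have := congrFun (congrFun hS (e j)) (e i)
    rw [Matrix.mul_apply] at this
    simp only [Matrix.mul_apply, Matrix.conjTranspose_apply, Matrix.of_apply, star_div₀]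
    have e1 : ∀ b, star (N (e i) b) / star (((Real.sqrt (l (e i)) : ℝ) : ℂ)) *
        (N (e j) b / ((Real.sqrt (l (e j)) : ℝ) : ℂ)) =
        N (e j) b * N.conjTranspose b (e i) /
          (((Real.sqrt (l (e i)) : ℝ) : ℂ) * ((Real.sqrt (l (e j)) : ℝ) : ℂ)) := fun b => by
      rw [Matrix.conjTranspose_apply]
      simp only [RCLike.star_def, Complex.conj_ofReal]
      ring
    simp only [e1]
    rw [← Finset.sum_div, this]
    by_cases hij : i = j
    · subst hij
      rw [Matrix.diagonal_apply_eq, Matrix.one_apply_eq, ← Complex.ofReal_mul,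
        Real.mul_self_sqrt (hl _), div_self]
      exact_mod_cast (e i).2.ne'
    · rw [Matrix.diagonal_apply_ne, Matrix.one_apply_ne hij, zero_div]
      exact fun h => hij (e.injective (Subtype.ext h.symm))
  · conv_lhs => rw [hMN]
    ext a b
    rw [Matrix.mul_apply, Matrix.mul_apply]
    simp only [Matrix.mul_diagonal, Matrix.submatrix_apply, id, Matrix.transpose_apply,
      Matrix.of_apply]
    rw [e.sum_comp (fun i : I => U a i * ((Real.sqrt (l i) : ℝ) : ℂ) *
      (N i b / ((Real.sqrt (l i) : ℝ) : ℂ)))]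
    have e2 : ∀ i : I, U a i * ((Real.sqrt (l i) : ℝ) : ℂ) *
      (N i b / ((Real.sqrt (l i) : ℝ) : ℂ)) = U a i * N i b := fun i => by
      have := hsq i
      field_simp
    simp only [e2]
    symm
    -- Rows with eigenvalue `0` vanish by `hrow`, so nothing is lost by restricting to `I`.
    rw [← Finset.sum_filter_of_ne (p := fun i => 0 < l i)]
    · exact (Finset.sum_subtype (p := fun i => 0 < l i) (Finset.univ.filter fun i => 0 < l i)
        (fun i => by simp) fun i => U a i * N i b).symm
    · intro i _ hi
      exact (hl i).lt_of_ne fun h => hi (by rw [hrow i h.symm b, mul_zero])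

end SingularValues

/-! ### Singular values of Kronecker products, scalar multiples and block sums -/

section SingularValues

variable {A B C D ι κ : Type} [Fintype A] [Fintype B] [Fintype C] [Fintype D] [Fintype ι] [DecidableEq ι] [Fintype κ] [DecidableEq κ]

theorem IsSingularDecomp.kronecker {M : Matrix A B ℂ} {N : Matrix C D ℂ} {p : ι → ℝ} {q : κ → ℝ}
    (h : IsSingularDecomp M p) (h' : IsSingularDecomp N q) :
    IsSingularDecomp (M ⊗ₖ N) fun i : ι × κ => p i.1 * q i.2 := by
  obtain ⟨hp, W, V, hW, hV, hM⟩ := h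
  obtain ⟨hq, W', V', hW', hV', hN⟩ := h'
  refine ⟨fun i => mul_nonneg (hp _) (hq _), W ⊗ₖ W', V ⊗ₖ V', ?_, ?_, ?_⟩
  · rw [Matrix.conjTranspose_kronecker, ← Matrix.mul_kronecker_mul, hW, hW',
      Matrix.one_kronecker_one]
  · rw [Matrix.conjTranspose_kronecker, ← Matrix.mul_kronecker_mul, hV, hV',
      Matrix.one_kronecker_one]
  · have : (Matrix.diagonal fun i : ι × κ => ((Real.sqrt (p i.1 * q i.2) : ℝ) : ℂ)) =
        (Matrix.diagonal fun i => ((Real.sqrt (p i) : ℝ) : ℂ)) ⊗ₖ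
          (Matrix.diagonal fun i => ((Real.sqrt (q i) : ℝ) : ℂ)) := by
      rw [Matrix.diagonal_kronecker_diagonal]
      congr 1
      funext i
      rw [Real.sqrt_mul (hp _), Complex.ofReal_mul]
    rw [this]
    have ht : (V ⊗ₖ V').transpose = V.transpose ⊗ₖ V'.transpose := rfl
    rw [ht, ← Matrix.mul_kronecker_mul, ← Matrix.mul_kronecker_mul, ← hM, ← hN]

theorem IsSingularDecomp.smul {M : Matrix A B ℂ} {p : ι → ℝ} (h : IsSingularDecomp M p) (c : ℂ) :
    IsSingularDecomp (c • M) fun i => ‖c‖ ^ 2 * p i := by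
  obtain ⟨hp, W, V, hW, hV, hM⟩ := h
  -- The phase of `c` goes into the isometry `W` and its modulus into the singular values; for `c =
  -- 0` any phase serves.
  obtain ⟨u, hu, hc⟩ : ∃ u : ℂ, star u * u = 1 ∧ c = u * (‖c‖ : ℝ) := by
    by_cases h : c = 0
    · exact ⟨1, by simp, by simp [h]⟩
    · have h' : ((‖c‖ : ℝ) : ℂ) ≠ 0 := by simpa using h
      refine ⟨c / (‖c‖ : ℝ), ?_, by field_simp⟩
      rw [star_div₀, RCLike.star_def, Complex.conj_ofReal, div_mul_div_comm,
        mul_comm, Complex.mul_conj, Complex.normSq_eq_norm_sq, Complex.ofReal_pow, sq]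
      exact div_self (mul_ne_zero h' h')
  refine ⟨fun i => mul_nonneg (sq_nonneg _) (hp i), u • W, V, ?_, hV, ?_⟩
  · rw [Matrix.conjTranspose_smul, Matrix.smul_mul, Matrix.mul_smul, hW, smul_smul, hu, one_smul]
  · have : (Matrix.diagonal fun i => ((Real.sqrt (‖c‖ ^ 2 * p i) : ℝ) : ℂ)) =
        ((‖c‖ : ℝ) : ℂ) • Matrix.diagonal fun i => ((Real.sqrt (p i) : ℝ) : ℂ) := by
      rw [← Matrix.diagonal_smul]
      congr 1
      funext i
      rw [Real.sqrt_mul (sq_nonneg _), Real.sqrt_sq (norm_nonneg _), Complex.ofReal_mul]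
      rfl
    rw [this, Matrix.mul_smul, Matrix.smul_mul, Matrix.smul_mul, Matrix.smul_mul, smul_smul,
      mul_comm, ← hc, hM]

theorem IsSingularDecomp.fromBlocks {M : Matrix A B ℂ} {N : Matrix C D ℂ} {p : ι → ℝ} {q : κ → ℝ}
    (h : IsSingularDecomp M p) (h' : IsSingularDecomp N q) :
    IsSingularDecomp (Matrix.fromBlocks M 0 0 N) (Sum.elim p q) := by
  obtain ⟨hp, W, V, hW, hV, hM⟩ := h
  obtain ⟨hq, W', V', hW', hV', hN⟩ := h'
  refine ⟨by rintro (i | i); exacts [hp i, hq i], Matrix.fromBlocks W 0 0 W',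
    Matrix.fromBlocks V 0 0 V', ?_, ?_, ?_⟩
  · simp [Matrix.fromBlocks_conjTranspose, Matrix.fromBlocks_multiply, hW, hW']
  · simp [Matrix.fromBlocks_conjTranspose, Matrix.fromBlocks_multiply, hV, hV']
  · have : (Matrix.diagonal fun i => ((Real.sqrt (Sum.elim p q i) : ℝ) : ℂ)) =
        Matrix.fromBlocks (Matrix.diagonal fun i => ((Real.sqrt (p i) : ℝ) : ℂ)) 0 0
          (Matrix.diagonal fun i => ((Real.sqrt (q i) : ℝ) : ℂ)) := by
      rw [Matrix.fromBlocks_diagonal]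
      congr 1
      funext i
      cases i <;> rfl
    rw [this]
    simp only [Matrix.fromBlocks_transpose, Matrix.fromBlocks_multiply, hM, hN, Matrix.transpose_zero,
      Matrix.mul_zero, Matrix.zero_mul, add_zero, zero_add]

variable [DecidableEq A] [DecidableEq C]

theorem singularPowSum_fromBlocks (α : ℝ) (M : Matrix A B ℂ) (N : Matrix C D ℂ) :
    singularPowSum α (Matrix.fromBlocks M 0 0 N) = singularPowSum α M + singularPowSum α N := by
  obtain ⟨r, p, -, h⟩ := exists_isSingularDecomp M
  obtain ⟨s, q, -, h'⟩ := exists_isSingularDecomp N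
  rw [(h.fromBlocks h').singularPowSum_eq, h.singularPowSum_eq, h'.singularPowSum_eq,
    Fintype.sum_sum_type]
  rfl

theorem singularPowSum_kronecker (α : ℝ) (M : Matrix A B ℂ) (N : Matrix C D ℂ) :
    singularPowSum α (M ⊗ₖ N) = singularPowSum α M * singularPowSum α N := by
  obtain ⟨r, p, -, h⟩ := exists_isSingularDecomp M
  obtain ⟨s, q, -, h'⟩ := exists_isSingularDecomp N
  rw [(h.kronecker h').singularPowSum_eq, h.singularPowSum_eq, h'.singularPowSum_eq,
    Fintype.sum_prod_type, Finset.sum_mul_sum]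
  exact Finset.sum_congr rfl fun i _ => Finset.sum_congr rfl fun j _ =>
    supportRpow_mul (h.1 i) (h'.1 j)

theorem singularPowSum_smul (α : ℝ) (c : ℂ) (M : Matrix A B ℂ) :
    singularPowSum α (c • M) = supportRpow α (‖c‖ ^ 2) * singularPowSum α M := by
  obtain ⟨r, p, -, h⟩ := exists_isSingularDecomp M
  rw [(h.smul c).singularPowSum_eq, h.singularPowSum_eq, Finset.mul_sum]
  exact Finset.sum_congr rfl fun i _ => supportRpow_mul (sq_nonneg _) (h.1 i)

/-! ### Superadditivity of the Schatten quasi-norms with exponent at most one -/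

theorem sum_normSq_row_of_mul_conjTranspose {T : Matrix A A ℂ} (h : T * T.conjTranspose = 1)
    (j : A) : ∑ i, Complex.normSq (T j i) = 1 := by
  have := congrFun (congrFun h j) j
  rw [Matrix.mul_apply, Matrix.one_apply_eq] at this
  have h2 : ((∑ i, Complex.normSq (T j i) : ℝ) : ℂ) = (1 : ℝ) := by
    rw [Complex.ofReal_sum, Complex.ofReal_one, ← this]
    exact Finset.sum_congr rfl fun i _ => (Complex.mul_conj _).symm
  exact_mod_cast h2

/-- Concavity of `x ^ α`: the power sum of the eigenvalues is at most that of the diagonal entries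
in any orthonormal basis. -/
theorem singularPowSum_le_sum_diag {α : ℝ} (h0 : 0 < α) (h1 : α ≤ 1) (N : Matrix A B ℂ)
    {U : Matrix A A ℂ} (hU : U.conjTranspose * U = 1) :
    singularPowSum α N ≤
      ∑ j, ((U.conjTranspose * (N * N.conjTranspose) * U) j j).re ^ α := by
  have hH := Matrix.isHermitian_mul_conjTranspose_self N
  let V : Matrix A A ℂ := hH.eigenvectorUnitary
  let l := hH.eigenvalues
  have hV1 : V.conjTranspose * V = 1 := Unitary.coe_star_mul_self hH.eigenvectorUnitary
  have hV2 : V * V.conjTranspose = 1 := Unitary.coe_mul_star_self hH.eigenvectorUnitary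
  have hU2 : U * U.conjTranspose = 1 := mul_eq_one_comm.mp hU
  have hl : ∀ i, 0 ≤ l i := eigenvalues_mul_conjTranspose_nonneg N
  set T := U.conjTranspose * V with hT
  have hT1 : T * T.conjTranspose = 1 := by
    rw [hT, Matrix.conjTranspose_mul, Matrix.conjTranspose_conjTranspose, Matrix.mul_assoc,
      ← Matrix.mul_assoc V, hV2, Matrix.one_mul, hU]
  have hT2 : T.conjTranspose * T.conjTranspose.conjTranspose = 1 := by
    rw [Matrix.conjTranspose_conjTranspose]
    exact mul_eq_one_comm.mp hT1
  -- `T` is unitary, so the matrix of `|T j i|²` is doubly stochastic: the row sums give the weights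
  -- for Jensen, the column sums recover the power sum of the eigenvalues.
  have hrow := sum_normSq_row_of_mul_conjTranspose hT1
  have hcol : ∀ i, ∑ j, Complex.normSq (T j i) = 1 := fun i => by
    simpa using sum_normSq_row_of_mul_conjTranspose hT2 i
  have hdiag : ∀ j, ((U.conjTranspose * (N * N.conjTranspose) * U) j j).re =
      ∑ i, Complex.normSq (T j i) * l i := fun j => by
    have hs : N * N.conjTranspose = V * Matrix.diagonal (fun i => (l i : ℂ)) * V.conjTranspose := by
      have := hH.spectral_theorem
      rwa [Unitary.conjStarAlgAut_apply] at this
    have e : U.conjTranspose * (N * N.conjTranspose) * U =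
        T * Matrix.diagonal (fun i => (l i : ℂ)) * T.conjTranspose := by
      rw [hs, hT]; simp [Matrix.mul_assoc]
    rw [e, Matrix.mul_apply, Complex.re_sum]
    refine Finset.sum_congr rfl fun i _ => ?_
    rw [Matrix.mul_diagonal, Matrix.conjTranspose_apply, mul_right_comm, RCLike.star_def,
      Complex.mul_conj, ← Complex.ofReal_mul, Complex.ofReal_re]
  calc singularPowSum α N = ∑ i, l i ^ α :=
        Finset.sum_congr rfl fun i _ => supportRpow_of_exponent_pos h0 _
    _ = ∑ j, ∑ i, Complex.normSq (T j i) * l i ^ α := by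
        rw [Finset.sum_comm]
        exact Finset.sum_congr rfl fun i _ => by rw [← Finset.sum_mul, hcol, one_mul]
    _ ≤ _ := Finset.sum_le_sum fun j _ => by
        rw [hdiag]
        exact (Real.concaveOn_rpow h0.le h1).le_map_sum
          (fun i _ => Complex.normSq_nonneg _) (hrow j) (fun i _ => hl i)

/-- Minkowski's inequality for finite sums. -/
theorem lp_sum_le {p : ℝ} (hp : 1 ≤ p) {I J : Type} [Fintype I] (s : Finset J) (a : I → J → ℝ)
    (ha : ∀ i j, 0 ≤ a i j) :
    (∑ i, (∑ j ∈ s, a i j) ^ p) ^ (1 / p) ≤ ∑ j ∈ s, (∑ i, a i j ^ p) ^ (1 / p) := by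
  classical
  have hp0 : p ≠ 0 := by positivity
  induction s using Finset.induction_on with
  | empty => simp [Real.zero_rpow hp0, Real.zero_rpow (inv_ne_zero hp0)]
  | insert j s hj ih =>
    simp only [Finset.sum_insert hj]
    exact (Real.Lp_add_le_of_nonneg Finset.univ hp (fun i _ => ha i j)
      (fun i _ => Finset.sum_nonneg fun j _ => ha i j)).trans (by gcongr)

/-- The reverse Minkowski inequality. -/
theorem sum_rpow_inv_le {α : ℝ} (h0 : 0 < α) (h1 : α ≤ 1) {I J : Type} [Fintype I] [Fintype J]
    (d : I → J → ℝ) (hd : ∀ i j, 0 ≤ d i j) :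
    ∑ i, (∑ j, d i j ^ α) ^ α⁻¹ ≤ (∑ j, (∑ i, d i j) ^ α) ^ α⁻¹ := by
  -- Ordinary Minkowski with exponent `1/α ≥ 1`, applied to the `α`-th powers; raising the result to
  -- the power `1/α` reverses the roles.
  have h := lp_sum_le (p := α⁻¹) ((one_le_inv₀ h0).mpr h1) Finset.univ (fun i j => d i j ^ α)
    (fun i j => Real.rpow_nonneg (hd i j) α)
  simp only [Real.rpow_rpow_inv (hd _ _) h0.ne', one_div, inv_inv] at h
  have hS : 0 ≤ ∑ i, (∑ j, d i j ^ α) ^ α⁻¹ := Finset.sum_nonneg fun i _ =>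
    Real.rpow_nonneg (Finset.sum_nonneg fun j _ => Real.rpow_nonneg (hd i j) α) _
  calc _ = ((∑ i, (∑ j, d i j ^ α) ^ α⁻¹) ^ α) ^ α⁻¹ := (Real.rpow_rpow_inv hS h0.ne').symm
    _ ≤ _ := Real.rpow_le_rpow (Real.rpow_nonneg hS α) h (inv_nonneg.mpr h0.le)

/-- Everything is read off in an eigenbasis of `M Mᴴ`. Concavity bounds the power sum of each `N k`
by that of its diagonal entries there, reverse Minkowski merges the diagonals, and their sum lies
below the eigenvalues of `M Mᴴ` by hypothesis. -/
theorem sum_singularPowSum_rpow_inv_le {α : ℝ} (h0 : 0 < α) (h1 : α ≤ 1) {K : Type} [Fintype K]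
    (M : Matrix A B ℂ) (N : K → Matrix A D ℂ)
    (h : (M * M.conjTranspose - ∑ k, N k * (N k).conjTranspose).PosSemidef) :
    ∑ k, singularPowSum α (N k) ^ α⁻¹ ≤ singularPowSum α M ^ α⁻¹ := by
  have hH := Matrix.isHermitian_mul_conjTranspose_self M
  let U : Matrix A A ℂ := hH.eigenvectorUnitary
  have hU : U.conjTranspose * U = 1 := Unitary.coe_star_mul_self hH.eigenvectorUnitary
  have hdiag : U.conjTranspose * (M * M.conjTranspose) * U =
      Matrix.diagonal fun i => (hH.eigenvalues i : ℂ) := by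
    have := hH.conjStarAlgAut_star_eigenvectorUnitary
    rwa [Unitary.conjStarAlgAut_star_apply] at this
  set d : K → A → ℝ := fun k j =>
    ((U.conjTranspose * (N k * (N k).conjTranspose) * U) j j).re with hd
  have hd0 : ∀ k j, 0 ≤ d k j := fun k j => by
    have := ((Matrix.posSemidef_self_mul_conjTranspose (N k)).conjTranspose_mul_mul_same U
      ).diag_nonneg (i := j)
    exact (Complex.le_def.mp this).1
  have hle : ∀ j, ∑ k, d k j ≤ hH.eigenvalues j := fun j => by
    have := (h.conjTranspose_mul_mul_same U).diag_nonneg (i := j)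
    have := (Complex.le_def.mp this).1
    rw [Matrix.mul_sub, Matrix.sub_mul, hdiag, Matrix.sub_apply, Matrix.diagonal_apply_eq,
      Finset.mul_sum, Finset.sum_mul, Matrix.sum_apply, Complex.sub_re, Complex.re_sum] at this
    exact sub_nonneg.mp this
  calc ∑ k, singularPowSum α (N k) ^ α⁻¹
      ≤ ∑ k, (∑ j, d k j ^ α) ^ α⁻¹ := Finset.sum_le_sum fun k _ =>
        Real.rpow_le_rpow (singularPowSum_nonneg _ _) (singularPowSum_le_sum_diag h0 h1 _ hU)
          (inv_nonneg.mpr h0.le)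
    _ ≤ (∑ j, (∑ k, d k j) ^ α) ^ α⁻¹ := sum_rpow_inv_le h0 h1 d hd0
    _ ≤ singularPowSum α M ^ α⁻¹ := by
        refine Real.rpow_le_rpow (Finset.sum_nonneg fun j _ => Real.rpow_nonneg
          (Finset.sum_nonneg fun k _ => hd0 k j) _) (Finset.sum_le_sum fun j _ => ?_)
          (inv_nonneg.mpr h0.le)
        rw [supportRpow_of_exponent_pos h0]
        exact Real.rpow_le_rpow (Finset.sum_nonneg fun k _ => hd0 k j) (hle j) h0.le

end SingularValues

/-! ### LOCC channels on ensembles of pure states -/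

/-- The unnormalised pure state `|w⟩⟨w| ⊗ |x⟩⟨x|`. -/
noncomputable def pureState {H X : Type} [DecidableEq X] (w : H → ℂ) (x : X) :
    Matrix (H × X) (H × X) ℂ :=
  Matrix.vecMulVec w (star w) ⊗ₖ Matrix.single x x (1 : ℂ)

/-- A single Kraus operator keeps a pure state pure. A mismatch with the register is encoded as the
zero vector, so that all branches have one form. -/
theorem conj_pureState {H H' X Y : Type} [Fintype H] [Fintype X] [DecidableEq X] [DecidableEq Y]
    (L : Matrix H' H ℂ) (x x' : X) (y : Y) (w : H → ℂ) :
    (L ⊗ₖ Matrix.single y x' (1 : ℂ)) * pureState w x *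
      (L ⊗ₖ Matrix.single y x' (1 : ℂ)).conjTranspose =
      pureState (if x' = x then L.mulVec w else 0) y := by
  rw [pureState, pureState, Matrix.conjTranspose_kronecker, Matrix.conjTranspose_single, star_one,
    ← Matrix.mul_kronecker_mul, ← Matrix.mul_kronecker_mul, BipartiteVector.conj_vecMulVec]
  split_ifs with h
  · subst h
    simp
  · rw [Matrix.single_mul_single_of_ne (h := h)]
    simp

theorem fstMap_pureState (S : StateSpace) (A' Y : Type) [Fintype A'] [DecidableEq A']
    [Fintype Y] [DecidableEq Y] {J : Type} [Fintype J] (f : J → S.X) (g : J → Y)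
    (K : J → Matrix A' S.A ℂ) (w : S.A × S.B → ℂ) (x : S.X) :
    fstMap S A' Y f g K (pureState w x) =
      ∑ j, pureState (if f j = x then (K j ⊗ₖ (1 : Matrix S.B S.B ℂ)).mulVec w else 0) (g j) :=
  Finset.sum_congr rfl fun _ _ => conj_pureState _ _ _ _ _

theorem sndMap_pureState (S : StateSpace) (B' Y : Type) [Fintype B'] [DecidableEq B']
    [Fintype Y] [DecidableEq Y] {J : Type} [Fintype J] (f : J → S.X) (g : J → Y)
    (K : J → Matrix B' S.B ℂ) (w : S.A × S.B → ℂ) (x : S.X) :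
    sndMap S B' Y f g K (pureState w x) =
      ∑ j, pureState (if f j = x then ((1 : Matrix S.A S.A ℂ) ⊗ₖ K j).mulVec w else 0) (g j) :=
  Finset.sum_congr rfl fun _ _ => conj_pureState _ _ _ _ _

theorem sum_conj_sum {H H' I J : Type} [Fintype H] [Fintype I] [Fintype J]
    (L : J → Matrix H' H ℂ) (ρ : I → Matrix H H ℂ) :
    ∑ j, L j * (∑ i, ρ i) * (L j).conjTranspose =
      ∑ i, ∑ j, L j * ρ i * (L j).conjTranspose := by
  simp only [Matrix.mul_sum, Matrix.sum_mul]
  exact Finset.sum_comm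

theorem fstMap_sum (S : StateSpace) (A' Y : Type) [Fintype A'] [DecidableEq A']
    [Fintype Y] [DecidableEq Y] {J : Type} [Fintype J] (f : J → S.X) (g : J → Y)
    (K : J → Matrix A' S.A ℂ) {I : Type} [Fintype I] (ρ : I → S.Op) :
    fstMap S A' Y f g K (∑ i, ρ i) = ∑ i, fstMap S A' Y f g K (ρ i) :=
  sum_conj_sum _ _

theorem sndMap_sum (S : StateSpace) (B' Y : Type) [Fintype B'] [DecidableEq B']
    [Fintype Y] [DecidableEq Y] {J : Type} [Fintype J] (f : J → S.X) (g : J → Y)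
    (K : J → Matrix B' S.B ℂ) {I : Type} [Fintype I] (ρ : I → S.Op) :
    sndMap S B' Y f g K (∑ i, ρ i) = ∑ i, sndMap S B' Y f g K (ρ i) :=
  sum_conj_sum _ _

/-- The block at register value `x` is a principal submatrix of the Kraus defect. -/
theorem KrausCondition.posSemidef_slice {H H' X J : Type} [Fintype H] [DecidableEq H] [Fintype H']
    [Fintype X] [DecidableEq X] [Fintype J] {f : J → X} {K : J → Matrix H' H ℂ}
    (h : KrausCondition f K) (x : X) :
    (1 - ∑ j, if f j = x then (K j).conjTranspose * K j else 0).PosSemidef := by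
  have := Matrix.PosSemidef.submatrix h (fun a : H => (a, x))
  convert this using 1
  ext a b
  simp only [Matrix.sub_apply, Matrix.submatrix_apply, Matrix.sum_apply, Matrix.one_apply,
    Prod.mk.injEq, and_true, Matrix.kroneckerMap_apply]
  congr 1
  refine Finset.sum_congr rfl fun j _ => ?_
  by_cases hj : f j = x <;> simp [hj]

/-- The Schatten quasi-norm with exponent `α` of `Tr₂ |w⟩⟨w|`. -/
noncomputable def schattenQuasiNorm {A B : Type} [Fintype A] [DecidableEq A] [Fintype B] (α : ℝ)
    (w : A × B → ℂ) : ℝ :=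
  singularPowSum α (Matrix.of fun a b => w (a, b)) ^ α⁻¹

/-! ### Monotonicity under LOCC -/

section Monotone

variable {α : ℝ}

/-- An operator `K` on the second system acts on coefficient matrices by `M ↦ M Kᵀ`, so the loss in
`M Mᴴ` is the transposed Kraus defect conjugated by `M`, which is positive semidefinite. -/
theorem sum_singularPowSum_mul_transpose_le (h0 : 0 < α) (h1 : α ≤ 1) {A B B' X J : Type}
    [Fintype A] [DecidableEq A] [Fintype B] [DecidableEq B] [Fintype B'] [Fintype X]
    [DecidableEq X] [Fintype J] {f : J → X} {K : J → Matrix B' B ℂ} (h : KrausCondition f K)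
    (x : X) (M : Matrix A B ℂ) :
    ∑ j, singularPowSum α (if f j = x then M * (K j).transpose else 0) ^ α⁻¹ ≤
      singularPowSum α M ^ α⁻¹ := by
  refine sum_singularPowSum_rpow_inv_le h0 h1 M _ ?_
  have e : M * M.conjTranspose -
      ∑ j, (if f j = x then M * (K j).transpose else 0) *
        (if f j = x then M * (K j).transpose else 0).conjTranspose =
      M * (1 - ∑ j, if f j = x then (K j).conjTranspose * K j else 0).transpose *
        M.conjTranspose := by
    rw [Matrix.transpose_sub, Matrix.transpose_one, Matrix.mul_sub, Matrix.sub_mul, Matrix.mul_one,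
      Matrix.transpose_sum, Matrix.mul_sum, Matrix.sum_mul]
    congr 1
    refine Finset.sum_congr rfl fun j _ => ?_
    split_ifs
    · rw [Matrix.transpose_mul, Matrix.conjTranspose_mul]
      simp only [Matrix.mul_assoc]
      rfl
    · simp
  rw [e]
  exact (h.posSemidef_slice x).transpose.mul_mul_conjTranspose_same M

theorem sum_schattenQuasiNorm_snd_le (h0 : 0 < α) (h1 : α ≤ 1) {A B B' X J : Type}
    [Fintype A] [DecidableEq A] [Fintype B] [DecidableEq B] [Fintype B'] [Fintype X]
    [DecidableEq X] [Fintype J] {f : J → X} {K : J → Matrix B' B ℂ} (h : KrausCondition f K)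
    (x : X) (w : A × B → ℂ) :
    ∑ j, schattenQuasiNorm α (if f j = x then ((1 : Matrix A A ℂ) ⊗ₖ K j).mulVec w else 0) ≤
      schattenQuasiNorm α w := by
  refine le_trans (le_of_eq ?_) (sum_singularPowSum_mul_transpose_le h0 h1 h x
    (Matrix.of fun a b => w (a, b)))
  refine Finset.sum_congr rfl fun j _ => ?_
  rw [schattenQuasiNorm]
  congr 2
  ext a b
  split_ifs
  · simp only [Matrix.of_apply]
    rw [BipartiteVector.kronecker_mulVec, Matrix.one_mul]
  · rfl

theorem sum_schattenQuasiNorm_fst_le (h0 : 0 < α) (h1 : α ≤ 1) {A A' B X J : Type}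
    [Fintype A] [DecidableEq A] [Fintype A'] [DecidableEq A'] [Fintype B] [DecidableEq B]
    [Fintype X] [DecidableEq X] [Fintype J] {f : J → X} {K : J → Matrix A' A ℂ}
    (h : KrausCondition f K) (x : X) (w : A × B → ℂ) :
    ∑ j, schattenQuasiNorm α (if f j = x then (K j ⊗ₖ (1 : Matrix B B ℂ)).mulVec w else 0) ≤
      schattenQuasiNorm α w := by
  have key := sum_singularPowSum_mul_transpose_le h0 h1 h x
    (Matrix.of fun a b => w (a, b)).transpose
  rw [singularPowSum_transpose] at key
  refine le_trans (le_of_eq ?_) key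
  refine Finset.sum_congr rfl fun j _ => ?_
  rw [schattenQuasiNorm, ← singularPowSum_transpose]
  congr 2
  ext b a
  split_ifs
  · rw [← Matrix.transpose_mul, Matrix.transpose_apply, Matrix.transpose_apply, Matrix.of_apply,
      BipartiteVector.kronecker_mulVec, Matrix.transpose_one, Matrix.mul_one]
  · rfl

/-- An ensemble `∑ k, |u k⟩⟨u k| ⊗ |y k⟩⟨y k|` obtained from `w` without increasing the sum of the
quasi-norms. -/
def IsEnsembleBelow {A B A' B' X : Type} [Fintype A] [DecidableEq A] [Fintype B] [Fintype A']
    [DecidableEq A'] [Fintype B'] [DecidableEq X] (α : ℝ) (w : A × B → ℂ)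
    (ρ : Matrix ((A' × B') × X) ((A' × B') × X) ℂ) : Prop :=
  ∃ (I : Type) (_ : Fintype I) (u : I → A' × B' → ℂ) (y : I → X),
    ρ = ∑ i, pureState (u i) (y i) ∧ ∑ i, schattenQuasiNorm α (u i) ≤ schattenQuasiNorm α w

/-- The invariant carried through a protocol. Branches are indexed by pairs (old branch, Kraus
operator), so each stays pure even if the register forgets the outcome. -/
theorem IsOneStepLOCC.isEnsembleBelow (h0 : 0 < α) (h1 : α ≤ 1) {T R : StateSpace}
    {Γ : T.Op → R.Op} (h : IsOneStepLOCC T R Γ) {A B : Type} [Fintype A] [DecidableEq A]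
    [Fintype B] {w : A × B → ℂ} {ρ : T.Op} (hρ : IsEnsembleBelow α w ρ) :
    IsEnsembleBelow α w (Γ ρ) := by
  obtain ⟨I, _, u, y, rfl, hw⟩ := hρ
  cases h with
  | fst A' Y J f g K hK =>
    refine ⟨I × J, inferInstance, fun k => if f k.2 = y k.1 then
      (K k.2 ⊗ₖ (1 : Matrix T.B T.B ℂ)).mulVec (u k.1) else 0, fun k => g k.2, ?_, ?_⟩
    · rw [fstMap_sum, Fintype.sum_prod_type]
      exact Finset.sum_congr rfl fun i _ => fstMap_pureState _ _ _ _ _ _ _ _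
    · rw [Fintype.sum_prod_type]
      exact (Finset.sum_le_sum fun i _ =>
        sum_schattenQuasiNorm_fst_le h0 h1 hK (y i) (u i)).trans hw
  | snd B' Y J f g K hK =>
    refine ⟨I × J, inferInstance, fun k => if f k.2 = y k.1 then
      ((1 : Matrix T.A T.A ℂ) ⊗ₖ K k.2).mulVec (u k.1) else 0, fun k => g k.2, ?_, ?_⟩
    · rw [sndMap_sum, Fintype.sum_prod_type]
      exact Finset.sum_congr rfl fun i _ => sndMap_pureState _ _ _ _ _ _ _ _
    · rw [Fintype.sum_prod_type]
      exact (Finset.sum_le_sum fun i _ =>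
        sum_schattenQuasiNorm_snd_le h0 h1 hK (y i) (u i)).trans hw

theorem IsLOCC.isEnsembleBelow (h0 : 0 < α) (h1 : α ≤ 1) {S T : StateSpace} {Λ : S.Op → T.Op}
    (h : IsLOCC S T Λ) (w : S.A × S.B → ℂ) (x : S.X) :
    IsEnsembleBelow α w (Λ (pureState w x)) := by
  induction h with
  | id => exact ⟨Unit, inferInstance, fun _ => w, fun _ => x, by simp, by simp⟩
  | step _ hΓ ih => exact hΓ.isEnsembleBelow h0 h1 ih

/-- The members of an ensemble with pure average are multiples of one vector. -/
theorem exists_smul_of_sum_vecMulVec_eq {H I : Type} [Fintype H] [Fintype I] {ψ : H → ℂ}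
    (hψ : ψ ≠ 0) {u : I → H → ℂ}
    (h : ∑ i, Matrix.vecMulVec (u i) (star (u i)) = Matrix.vecMulVec ψ (star ψ)) :
    ∃ c : I → ℂ, (∀ i, u i = c i • ψ) ∧ ∑ i, ‖c i‖ ^ 2 = 1 := by
  have hq : ∀ z : H → ℂ, ∑ i, ‖star z ⬝ᵥ u i‖ ^ 2 = ‖star z ⬝ᵥ ψ‖ ^ 2 := fun z => by
    have e : ∀ v : H → ℂ, star z ⬝ᵥ (Matrix.vecMulVec v (star v)).mulVec z =
        ((‖star z ⬝ᵥ v‖ ^ 2 : ℝ) : ℂ) := fun v => by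
      have e' : star v ⬝ᵥ z = (starRingEnd ℂ) (star z ⬝ᵥ v) := by
        rw [← RCLike.star_def, Matrix.star_dotProduct]
      rw [Matrix.vecMulVec_mulVec, ← Complex.normSq_eq_norm_sq, ← Complex.mul_conj, ← e']
      simp [mul_comm]
    have := congrArg (fun ρ : Matrix H H ℂ => star z ⬝ᵥ ρ.mulVec z) h
    simp only [Matrix.sum_mulVec, dotProduct_sum, e] at this
    exact_mod_cast this
  have hz : star ψ ⬝ᵥ ψ ≠ 0 := fun h => hψ (dotProduct_star_self_eq_zero.mp h)
  -- Let `z` be the component of `u i` orthogonal to `ψ`. The quadratic form `hq` vanishes at `z`,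
  -- so `z` is orthogonal to `u i` too, hence to itself.
  have hdecomp : ∀ i, u i = ((star ψ ⬝ᵥ u i) / (star ψ ⬝ᵥ ψ)) • ψ := fun i => by
    set c := (star ψ ⬝ᵥ u i) / (star ψ ⬝ᵥ ψ) with hc
    set z := u i - c • ψ with hzdef
    have h1 : star ψ ⬝ᵥ z = 0 := by
      rw [hzdef, dotProduct_sub, dotProduct_smul, hc, smul_eq_mul, div_mul_cancel₀ _ hz, sub_self]
    have h2 : star z ⬝ᵥ ψ = 0 := by
      rw [← star_star (star z ⬝ᵥ ψ), Matrix.star_dotProduct, star_star, h1, star_zero]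
    have h3 := hq z
    rw [h2, norm_zero, zero_pow two_ne_zero,
      Finset.sum_eq_zero_iff_of_nonneg fun _ _ => sq_nonneg _] at h3
    have h4 : star z ⬝ᵥ u i = 0 := by simpa using h3 i (Finset.mem_univ i)
    have h5 : star z ⬝ᵥ z = 0 := by
      conv_lhs => rw [hzdef, dotProduct_sub, dotProduct_smul, ← hzdef, h2, h4]
      simp
    exact sub_eq_zero.mp (dotProduct_star_self_eq_zero.mp h5)
  refine ⟨_, hdecomp, ?_⟩
  have := hq ψ
  have hn : ‖star ψ ⬝ᵥ ψ‖ ^ 2 ≠ 0 := pow_ne_zero _ (norm_ne_zero_iff.mpr hz)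
  simp only [norm_div, div_pow, ← Finset.sum_div, this, div_self hn]

/-- The outer exponent `α⁻¹` makes the quasi-norm of degree one in `‖c‖²`, so the branch weights of
a pure ensemble add up to `1`. -/
theorem schattenQuasiNorm_smul (h0 : 0 < α) {A B : Type} [Fintype A] [DecidableEq A] [Fintype B]
    (c : ℂ) (w : A × B → ℂ) :
    schattenQuasiNorm α (c • w) = ‖c‖ ^ 2 * schattenQuasiNorm α w := by
  have : (Matrix.of fun a b => (c • w) (a, b)) = c • Matrix.of fun a b => w (a, b) := rfl
  rw [schattenQuasiNorm, this, singularPowSum_smul, supportRpow_of_exponent_pos h0,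
    Real.mul_rpow (Real.rpow_nonneg (sq_nonneg _) _) (singularPowSum_nonneg _ _),
    Real.rpow_rpow_inv (sq_nonneg _) h0.ne', schattenQuasiNorm]

namespace BipartiteVector

theorem state_eq_pureState (φ : BipartiteVector) : φ.state = pureState φ.vec () := by
  have hs : Matrix.single () () (1 : ℂ) = 1 := by ext; simp
  rw [state, pureState, hs, ketbra]

theorem ConvertsTo.singularPowSum_le_of_pos (h0 : 0 < α) (h1 : α ≤ 1) {φ ψ : BipartiteVector}
    (h : ConvertsTo φ ψ) : singularPowSum α ψ.coeff ≤ singularPowSum α φ.coeff := by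
  -- A zero target has power sum `0`; the comparison of branches with `ψ` needs `ψ ≠ 0`.
  by_cases hψ : ψ.vec = 0
  · have : ψ.coeff = (0 : ℂ) • ψ.coeff := by
      ext a b
      simp [coeff, hψ]
    rw [this, singularPowSum_smul]
    simpa using singularPowSum_nonneg _ _
  obtain ⟨Λ, hΛ, e⟩ := h
  obtain ⟨I, _, u, y, hu, hle⟩ := hΛ.isEnsembleBelow h0 h1 φ.vec ()
  rw [← state_eq_pureState, e, state_eq_pureState] at hu
  have hu' : ∑ i, Matrix.vecMulVec (u i) (star (u i)) = Matrix.vecMulVec ψ.vec (star ψ.vec) := by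
    ext a b
    have := congrFun (congrFun hu (a, ())) (b, ())
    simp only [pureState, Matrix.sum_apply, Matrix.kroneckerMap_apply] at this
    simpa [Matrix.sum_apply] using this.symm
  obtain ⟨c, hc, hc1⟩ := exists_smul_of_sum_vecMulVec_eq hψ hu'
  simp only [hc, schattenQuasiNorm_smul h0, ← Finset.sum_mul, hc1, one_mul] at hle
  exact (Real.rpow_le_rpow_iff (singularPowSum_nonneg _ _) (singularPowSum_nonneg _ _)
    (inv_pos.mpr h0)).mp hle

/-- Thanks to the convention at zero eigenvalues, continuity in `α` holds even at `α = 0`, where the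
power sum is the rank. -/
theorem continuous_singularPowSum {A B : Type} [Fintype A] [DecidableEq A] [Fintype B]
    (M : Matrix A B ℂ) : Continuous fun α : ℝ => singularPowSum α M := by
  refine continuous_finsetSum _ fun i _ => ?_
  unfold supportRpow
  split_ifs with h
  · exact continuous_const
  · exact Real.continuous_const_rpow h

theorem ConvertsTo.singularPowSum_le (h0 : 0 ≤ α) (h1 : α ≤ 1) {φ ψ : BipartiteVector}
    (h : ConvertsTo φ ψ) : singularPowSum α ψ.coeff ≤ singularPowSum α φ.coeff := by
  rcases h0.eq_or_lt with rfl | h0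
  · have ht : ∀ φ : BipartiteVector, Filter.Tendsto (fun α : ℝ => singularPowSum α φ.coeff)
        (nhdsWithin 0 (Set.Ioi 0)) (nhds (singularPowSum 0 φ.coeff)) := fun φ =>
      ((continuous_singularPowSum φ.coeff).tendsto 0).mono_left nhdsWithin_le_nhds
    refine le_of_tendsto_of_tendsto (ht ψ) (ht φ) ?_
    filter_upwards [Ioc_mem_nhdsGT (zero_lt_one' ℝ)] with β hβ
    exact h.singularPowSum_le_of_pos hβ.1 hβ.2
  · exact h.singularPowSum_le_of_pos h0 h1

end BipartiteVector

end Monotone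

/-! ### The spectral functionals as monotone homomorphisms -/

namespace BipartiteVector

theorem partialTraceSnd_ketbra (φ : BipartiteVector) :
    partialTraceSnd φ.ketbra = φ.coeff * φ.coeff.conjTranspose := by
  ext a a'
  simp [partialTraceSnd, ketbra, coeff, Matrix.mul_apply, Matrix.vecMulVec_apply]

theorem spectralFunctional_eq_singularPowSum (α : ℝ) (φ : BipartiteVector) :
    spectralFunctional α φ = (singularPowSum α φ.coeff : ℂ) := by
  have hH := Matrix.isHermitian_mul_conjTranspose_self φ.coeff
  rw [spectralFunctional, partialTraceSnd_ketbra, supportPow, hH.cfc_eq, Matrix.IsHermitian.cfc,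
    Unitary.conjStarAlgAut_apply, Matrix.trace_mul_comm, ← Matrix.mul_assoc,
    Unitary.coe_star_mul_self, Matrix.one_mul, Matrix.trace_diagonal, singularPowSum,
    Complex.ofReal_sum]
  rfl

theorem isSingularDecomp_of_isSchmidtCoefficients {φ : BipartiteVector} {r : ℕ} {p : Fin r → ℝ}
    (h : IsSchmidtCoefficients φ p) : IsSingularDecomp φ.coeff p := by
  obtain ⟨hp, u, v, hu, hv, hφ⟩ := h
  have key : ∀ {X : Type} [Fintype X] {u : Fin r → EuclideanSpace ℂ X}, Orthonormal ℂ u →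
      (Matrix.of fun x i => u i x).conjTranspose * (Matrix.of fun x i => u i x) = 1 :=
    fun {X} _ {u} hu => by
      ext i j
      have := orthonormal_iff_ite.mp hu i j
      rw [EuclideanSpace.inner_eq_star_dotProduct] at this
      rw [Matrix.one_apply, ← this, Matrix.mul_apply, dotProduct]
      exact Finset.sum_congr rfl fun x _ => mul_comm _ _
  refine ⟨fun i => (hp i).le, Matrix.of fun a i => u i a, Matrix.of fun b i => v i b,
    key hu, key hv, ?_⟩
  ext a b
  rw [coeff, Matrix.of_apply, hφ, Matrix.mul_apply]
  refine Finset.sum_congr rfl fun i _ => ?_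
  rw [Matrix.mul_diagonal, Matrix.transpose_apply, Matrix.of_apply, Matrix.of_apply]
  ring

/-! ### Schmidt normal form -/

/-- The vector `√p |00⟩`. -/
noncomputable def scalar (p : ℝ) : BipartiteVector :=
  ⟨Unit, Unit, fun _ => ((Real.sqrt p : ℝ) : ℂ)⟩

/-- The vector `∑ i, √(p i) |ii⟩`. -/
noncomputable def schmidtForm {r : ℕ} (p : Fin r → ℝ) : BipartiteVector :=
  ⟨Fin r, Fin r, fun x => if x.1 = x.2 then ((Real.sqrt (p x.1) : ℝ) : ℂ) else 0⟩

theorem coeff_schmidtForm {r : ℕ} (p : Fin r → ℝ) :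
    (schmidtForm p).coeff = Matrix.diagonal fun i => ((Real.sqrt (p i) : ℝ) : ℂ) := by
  ext a b
  rfl

theorem coeff_zero : zero.coeff = (0 : ℂ) • zero.coeff := by
  ext a b
  exact (zero_mul _).symm

theorem isSingularDecomp_one :
    IsSingularDecomp (Matrix.of fun _ _ => 1 : Matrix Unit Unit ℂ) (fun _ : Unit => 1) :=
  ⟨fun _ => zero_le_one, 1, 1, by simp, by simp, by ext; simp⟩

/-- The isometries of the decomposition are themselves the required partial isometries. -/
theorem luEquiv_schmidtForm {φ : BipartiteVector} {r : ℕ} {p : Fin r → ℝ}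
    (h : IsSingularDecomp φ.coeff p) : LUEquiv (schmidtForm p) φ := by
  obtain ⟨-, W, V, hW, hV, hM⟩ := h
  have hV' := congrArg Matrix.transpose hV
  rw [Matrix.transpose_mul, Matrix.transpose_one] at hV'
  refine luEquiv_iff.mpr ⟨W, V, ?_, ?_, ?_, ?_⟩
  · exact (Matrix.mul_assoc _ _ _).trans ((congrArg _ hW).trans (Matrix.mul_one _))
  · exact (Matrix.mul_assoc _ _ _).trans ((congrArg _ hV).trans (Matrix.mul_one _))
  · rw [hM, coeff_schmidtForm]
    rfl
  · have e : W.conjTranspose * (W * Matrix.diagonal (fun i => ((Real.sqrt (p i) : ℝ) : ℂ)) *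
        V.transpose) * V.conjTranspose.transpose =
        (W.conjTranspose * W) * Matrix.diagonal (fun i => ((Real.sqrt (p i) : ℝ) : ℂ)) *
          (V.transpose * V.conjTranspose.transpose) := by
      simp only [Matrix.mul_assoc]
    rw [hW, hV', Matrix.one_mul, Matrix.mul_one] at e
    rw [hM, coeff_schmidtForm]
    exact e.symm

end BipartiteVector

namespace S2

open BipartiteVector

/-- The homomorphism `𝒮₂ → ℝ≥0` induced by `f_α`. -/
noncomputable def spectralHom {α : ℝ} (h0 : 0 ≤ α) (h1 : α ≤ 1) : S2 →+* ℝ≥0 where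
  toFun := Quotient.lift (fun φ => (⟨singularPowSum α φ.coeff, singularPowSum_nonneg _ _⟩ : ℝ≥0))
    -- Equivalent vectors convert into each other, so monotonicity already gives invariance.
    fun _ _ h => Subtype.ext (le_antisymm
      ((convertsTo_of_luEquiv (luEquiv_symm h)).singularPowSum_le h0 h1)
      ((convertsTo_of_luEquiv h).singularPowSum_le h0 h1))
  map_zero' := by
    refine Subtype.ext ?_
    change singularPowSum α zero.coeff = 0
    rw [coeff_zero, singularPowSum_smul]
    simp
  map_one' := by
    refine Subtype.ext ?_
    change singularPowSum α (Matrix.of fun _ _ => 1 : Matrix Unit Unit ℂ) = 1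
    rw [isSingularDecomp_one.singularPowSum_eq]
    simp [supportRpow]
  map_add' a b := by
    induction a, b using Quotient.inductionOn₂ with | h φ ψ => ?_
    refine Subtype.ext ?_
    change singularPowSum α (directSum φ ψ).coeff = _
    rw [coeff_directSum]
    exact singularPowSum_fromBlocks _ _ _
  map_mul' a b := by
    induction a, b using Quotient.inductionOn₂ with | h φ ψ => ?_
    refine Subtype.ext ?_
    change singularPowSum α (tensor φ ψ).coeff = _
    rw [coeff_tensor]
    exact singularPowSum_kronecker _ _ _

theorem spectralHom_mk {α : ℝ} (h0 : 0 ≤ α) (h1 : α ≤ 1) (φ : BipartiteVector) :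
    (spectralHom h0 h1 (mk φ) : ℝ) = singularPowSum α φ.coeff := rfl

theorem spectralHom_mem_asymptoticSpectrum {α : ℝ} (h0 : 0 ≤ α) (h1 : α ≤ 1) :
    spectralHom h0 h1 ∈ asymptoticSpectrum := by
  intro a b
  induction a, b using Quotient.inductionOn₂ with | h φ ψ => ?_
  exact fun h => ConvertsTo.singularPowSum_le h0 h1 h

/-! ### Classification of the monotone homomorphisms -/

/-- Induction that splits off the coefficient of index `0`; it makes a homomorphism determined by
its values on the vectors `√p |00⟩`. -/
theorem mk_schmidtForm {r : ℕ} (p : Fin r → ℝ) :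
    mk (schmidtForm p) = ∑ i, mk (scalar (p i)) := by
  induction r with
  | zero =>
    exact Quotient.sound (luEquiv_of_zero (funext fun x => x.1.elim0) rfl)
  | succ n ih =>
    rw [Fin.sum_univ_succ, ← ih fun i => p i.succ, mk_add]
    let e : Unit ⊕ Fin n ≃ Fin (n + 1) :=
      { toFun := Sum.elim (fun _ => 0) Fin.succ
        invFun := Fin.cases (Sum.inl ()) Sum.inr
        left_inv := by rintro (_ | _) <;> rfl
        right_inv := fun i => by cases i using Fin.cases <;> rfl }
    refine Quotient.sound (luEquiv_symm (luEquiv_of_equiv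
      (φ := directSum (scalar (p 0)) (schmidtForm fun i => p i.succ)) e e ?_))
    rintro (_ | a) (_ | b)
    · rfl
    · exact if_neg (t := ((Real.sqrt (p 0) : ℝ) : ℂ)) (Fin.succ_ne_zero b).symm
    · exact if_neg (t := ((Real.sqrt (p a.succ) : ℝ) : ℂ)) (Fin.succ_ne_zero a)
    · exact if_congr (Fin.succ_inj (a := (a : Fin n)) (b := (b : Fin n))) rfl rfl

theorem mk_scalar_one : mk (scalar 1) = 1 :=
  Quotient.sound (luEquiv_of_equiv (Equiv.refl Unit) (Equiv.refl Unit) fun _ _ => by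
    simp [scalar, one])

theorem mk_scalar_mul {p : ℝ} (hp : 0 ≤ p) (q : ℝ) :
    mk (scalar (p * q)) = mk (scalar p) * mk (scalar q) :=
  Quotient.sound (luEquiv_symm (luEquiv_of_equiv (φ := tensor (scalar p) (scalar q))
    (Equiv.punitProd Unit) (Equiv.punitProd Unit) fun _ _ => by
      simp [scalar, tensor, Real.sqrt_mul hp]))

end S2

/-! ### Explicit LOCC protocols -/

namespace BipartiteVector

theorem krausCondition_sqrt {x : ℝ} (hx : 0 ≤ x) (hx1 : x ≤ 1) :
    KrausCondition (fun _ : Unit => ())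
      (fun _ : Unit => (Matrix.of fun _ _ => ((Real.sqrt x : ℝ) : ℂ) : Matrix Unit Unit ℂ)) := by
  have e : (1 - ∑ j : Unit, ((Matrix.of fun _ _ => ((Real.sqrt x : ℝ) : ℂ) :
      Matrix Unit Unit ℂ).conjTranspose * (Matrix.of fun _ _ => ((Real.sqrt x : ℝ) : ℂ))) ⊗ₖ
      Matrix.single () () (1 : ℂ) : Matrix (Unit × Unit) (Unit × Unit) ℂ) =
      Matrix.diagonal fun _ => ((1 - x : ℝ) : ℂ) := by
    ext a b
    obtain rfl := Subsingleton.elim a b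
    simp [Matrix.mul_apply, ← Complex.ofReal_mul, Real.mul_self_sqrt hx]
  unfold KrausCondition
  rw [e]
  exact Matrix.PosSemidef.diagonal fun _ => Complex.zero_le_real.mpr (sub_nonneg.mpr hx1)

/-- Channels may lose trace: the first party applies the single Kraus operator `√(q/p) ≤ 1`. -/
theorem scalar_convertsTo {p q : ℝ} (hq : 0 < q) (hqp : q ≤ p) :
    ConvertsTo (scalar p) (scalar q) := by
  have hp := hq.trans_le hqp
  refine ⟨_, IsLOCC.step (IsLOCC.id _) (IsOneStepLOCC.fst (scalar p).space Unit Unit Unit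
    (fun _ => ()) (fun _ => ()) (fun _ => Matrix.of fun _ _ => ((Real.sqrt (q / p) : ℝ) : ℂ))
    (krausCondition_sqrt (by positivity) ((div_le_one hp).mpr hqp))), ?_⟩
  rw [state_eq_pureState, state_eq_pureState]
  refine (fstMap_pureState _ _ _ _ _ _ _ _).trans ?_
  simp only [Finset.univ_unique, Finset.sum_singleton, if_true]
  congr 1
  have hv : ((Matrix.of fun _ _ => ((Real.sqrt (q / p) : ℝ) : ℂ) : Matrix Unit Unit ℂ) ⊗ₖ
      (1 : Matrix Unit Unit ℂ)).mulVec (fun _ => ((Real.sqrt p : ℝ) : ℂ)) =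
      fun _ => ((Real.sqrt q : ℝ) : ℂ) := by
    ext ⟨a, b⟩
    rw [kronecker_mulVec, Matrix.transpose_one, Matrix.mul_one]
    simp only [Matrix.mul_apply, Matrix.of_apply, Finset.univ_unique, Finset.sum_singleton]
    rw [← Complex.ofReal_mul, ← Real.sqrt_mul (by positivity), div_mul_cancel₀ _ hp.ne']
  exact hv

/-- The unnormalised maximally entangled vector `∑ i, |ii⟩`. -/
def maximallyEntangled (I : Type) [Fintype I] [DecidableEq I] : BipartiteVector :=
  ⟨I, I, fun x => if x.1 = x.2 then 1 else 0⟩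

/-- Measuring a maximally entangled vector on both sides leaves a product vector. -/
theorem maximallyEntangled_convertsTo (I : Type) [Fintype I] [DecidableEq I] :
    ConvertsTo (maximallyEntangled I) (scalar (Fintype.card I)) := by
  let K : I → Matrix Unit I ℂ := fun i => Matrix.of fun _ a => if a = i then 1 else 0
  have hKK : ∀ i, (K i).conjTranspose * K i = Matrix.single i i (1 : ℂ) := fun i => by
    ext a b
    simp [K, Matrix.mul_apply, Matrix.single_apply, ← ite_and, eq_comm, and_comm]
  have h1 : KrausCondition (fun _ : I => ()) K := by
    have : (1 - ∑ j, ((K j).conjTranspose * K j) ⊗ₖ Matrix.single () () (1 : ℂ) :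
        Matrix (I × Unit) (I × Unit) ℂ) = 0 := by
      ext ⟨a, x⟩ ⟨b, y⟩
      simp [hKK, Matrix.sum_apply, Matrix.single_apply, Matrix.one_apply, ite_and]
    unfold KrausCondition
    rw [this]
    exact Matrix.PosSemidef.zero
  -- On register value `i` the second party applies only the projection onto `i`. The other outcomes
  -- are discarded, which is why the defect is nonzero, supported off the diagonal `x.1 = x.2`; they
  -- never occur on this input.
  have h2 : KrausCondition (id : I → I) K := by
    have : (1 - ∑ j, ((K j).conjTranspose * K j) ⊗ₖ Matrix.single (id j) (id j) (1 : ℂ) :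
        Matrix (I × I) (I × I) ℂ) = Matrix.diagonal fun x => if x.1 = x.2 then 0 else 1 := by
      ext ⟨a, x⟩ ⟨b, y⟩
      simp [hKK, Matrix.sum_apply, Matrix.single_apply, Matrix.one_apply, Matrix.diagonal_apply,
        ite_and]
      grind
    unfold KrausCondition
    rw [this]
    exact Matrix.PosSemidef.diagonal fun x => by split_ifs <;> simp
  refine ⟨_, IsLOCC.step (IsLOCC.step (IsLOCC.id _)
    (IsOneStepLOCC.fst (maximallyEntangled I).space Unit I I (fun _ => ()) id K h1))
    (IsOneStepLOCC.snd ((maximallyEntangled I).space.withFst Unit I) Unit Unit I id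
      (fun _ => ()) K h2), ?_⟩
  rw [state_eq_pureState, state_eq_pureState]
  refine (congrArg (sndMap _ _ _ _ _ _) (fstMap_pureState _ _ _ _ _ _ _ _)).trans ?_
  refine (sndMap_sum _ _ _ _ _ _ _).trans ?_
  refine (Finset.sum_congr rfl fun i _ => sndMap_pureState _ _ _ _ _ _ _ _).trans ?_
  let δ : I × I → ℂ := fun x => if x.1 = x.2 then 1 else 0
  -- Each outcome `i` leaves exactly `|00⟩`. Once the register is reset, the `Fintype.card I` equal
  -- branches add up to `card • |00⟩⟨00|`.
  have hv : ∀ i : I, ((1 : Matrix Unit Unit ℂ) ⊗ₖ K i).mulVec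
      ((K i ⊗ₖ (1 : Matrix I I ℂ)).mulVec δ) = fun _ => 1 := fun i => by
    have hw : (K i ⊗ₖ (1 : Matrix I I ℂ)).mulVec δ =
        fun x => if i = x.2 then 1 else 0 := by
      ext ⟨a, b⟩
      refine (kronecker_mulVec _ _ _ _ _).trans ?_
      simp [K, δ, Matrix.mul_apply, Matrix.one_apply, eq_comm]
    rw [hw]
    ext ⟨a, b⟩
    rw [kronecker_mulVec]
    simp [K, Matrix.mul_apply]
  have hsum : ∀ i : I, ∑ j : I, pureState (if id j = id i then
      ((1 : Matrix Unit Unit ℂ) ⊗ₖ K j).mulVec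
      (if () = () then (K i ⊗ₖ (1 : Matrix I I ℂ)).mulVec δ else 0)
      else 0) () = pureState (fun _ : Unit × Unit => (1 : ℂ)) () := fun i => by
    rw [Finset.sum_eq_single i]
    · simp [hv]
    · intro j _ hj
      rw [if_neg (show ¬ id j = id i from hj)]
      ext
      simp [pureState]
    · simp
  refine (Finset.sum_congr rfl fun i _ => hsum i).trans ?_
  ext ⟨x, z⟩ ⟨y, z'⟩
  have hs : ((Real.sqrt (Fintype.card I) : ℝ) : ℂ) *
      (starRingEnd ℂ) (Real.sqrt (Fintype.card I) : ℝ) =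
      Fintype.card I := by
    rw [Complex.conj_ofReal, ← Complex.ofReal_mul, Real.mul_self_sqrt (Nat.cast_nonneg _),
      Complex.ofReal_natCast]
  simp [pureState, scalar, Matrix.vecMulVec_apply]
  exact hs.symm

end BipartiteVector

/-- Monotone multiplicative functions on the positive reals are powers. -/
theorem exists_rpow_of_monotone_of_map_mul {h : ℝ → ℝ} (hnn : ∀ x, 0 ≤ h x) (hone : h 1 = 1)
    (hmul : ∀ x y, 0 < x → 0 < y → h (x * y) = h x * h y)
    (hmono : ∀ x y, 0 < x → x ≤ y → h x ≤ h y) :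
    ∃ α : ℝ, 0 ≤ α ∧ ∀ x, 0 < x → h x = x ^ α := by
  have hpos : ∀ x, 0 < x → 0 < h x := fun x hx => (hnn x).lt_of_ne fun h0 => by
    have := hmul x x⁻¹ hx (inv_pos.mpr hx)
    rw [mul_inv_cancel₀ hx.ne', hone, ← h0, zero_mul] at this
    exact one_ne_zero this
  -- In logarithmic coordinates `h` solves Cauchy's equation; monotonicity gives measurability,
  -- hence continuity, hence linearity. The exponent is the slope `L 1`.
  let L : ℝ →+ ℝ :=
    { toFun := fun t => Real.log (h (Real.exp t))
      map_zero' := by simp [hone]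
      map_add' := fun s t => by
        rw [Real.exp_add, hmul _ _ (Real.exp_pos s) (Real.exp_pos t),
          Real.log_mul (hpos _ (Real.exp_pos s)).ne' (hpos _ (Real.exp_pos t)).ne'] }
  have hL : Monotone L := fun s t hst => Real.log_le_log (hpos _ (Real.exp_pos s))
    (hmono _ _ (Real.exp_pos s) (Real.exp_le_exp.mpr hst))
  have hlin : ∀ t, L t = t * L 1 := fun t => by
    have := map_real_smul L (MeasureTheory.Measure.AddMonoidHom.continuous_of_measurable L hL.measurable) t 1
    simpa using this
  refine ⟨L 1, by simpa using hL zero_le_one, fun x hx => ?_⟩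
  have := hlin (Real.log x)
  change Real.log (h (Real.exp (Real.log x))) = _ at this
  rw [Real.exp_log hx] at this
  rw [Real.rpow_def_of_pos hx, ← this, Real.exp_log (hpos x hx)]

namespace S2

open BipartiteVector

/-- The class `1 + 1` is that of `|00⟩ + |11⟩`, the maximally entangled vector on two levels. This
comparison is what forces `α ≤ 1`. -/
theorem mk_scalar_two_le : mk (scalar 2) ≤ 1 + 1 := by
  have h := maximallyEntangled_convertsTo (Unit ⊕ Unit)
  have hc : ((Fintype.card (Unit ⊕ Unit) : ℕ) : ℝ) = 2 := by simp
  rw [hc] at h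
  refine convertsTo_trans (convertsTo_of_luEquiv ?_) h
  refine luEquiv_of_equiv (Equiv.refl (Unit ⊕ Unit)) (Equiv.refl (Unit ⊕ Unit)) ?_
  rintro (a | a) (b | b) <;> rfl

theorem exists_eq_spectralHom {f : S2 →+* ℝ≥0} (hf : f ∈ asymptoticSpectrum) :
    ∃ (α : ℝ) (h0 : 0 ≤ α) (h1 : α ≤ 1), f = spectralHom h0 h1 := by
  -- The tensor product gives multiplicativity in the squared amplitude, and damping gives
  -- monotonicity.
  obtain ⟨α, h0, hα⟩ := exists_rpow_of_monotone_of_map_mul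
    (h := fun x => (f (mk (scalar x)) : ℝ)) (fun x => NNReal.coe_nonneg _)
    (by rw [mk_scalar_one, map_one, NNReal.coe_one])
    (fun x y hx _ => by rw [mk_scalar_mul hx.le, map_mul, NNReal.coe_mul])
    (fun x y hx hxy => NNReal.coe_le_coe.mpr (hf (scalar_convertsTo hx hxy)))
  have h1 : α ≤ 1 := by
    have h2 : (f (mk (scalar 2)) : ℝ) ≤ f (1 + 1) := NNReal.coe_le_coe.mpr (hf mk_scalar_two_le)
    rw [hα 2 two_pos, map_add, map_one, NNReal.coe_add, NNReal.coe_one, one_add_one_eq_two] at h2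
    exact (Real.rpow_le_rpow_left_iff one_lt_two).mp (h2.trans_eq (Real.rpow_one 2).symm)
  refine ⟨α, h0, h1, RingHom.ext fun a => ?_⟩
  induction a using Quotient.inductionOn with | h φ => ?_
  -- Only strictly positive `p i` occur, so the power law for `f`, known on positive reals, applies
  -- to each summand, also when `α = 0`.
  obtain ⟨r, p, hp, h⟩ := exists_isSingularDecomp φ.coeff
  have e : mk φ = ∑ i, mk (scalar (p i)) := by
    rw [← mk_schmidtForm]
    exact Quotient.sound (luEquiv_symm (luEquiv_schmidtForm h))
  refine NNReal.coe_injective ?_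
  refine Eq.trans ?_ (spectralHom_mk h0 h1 φ).symm
  change (f (mk φ) : ℝ) = _
  rw [e, map_sum, NNReal.coe_sum, h.singularPowSum_eq]
  exact Finset.sum_congr rfl fun i _ => (hα _ (hp i)).trans (supportRpow_of_pos (hp i)).symm

end S2

theorem theorem4 :
    (fun (f : S2 →+* ℝ≥0) (φ : BipartiteVector) => ((f (S2.mk φ) : ℝ) : ℂ)) ''
        asymptoticSpectrum = spectralFunctional '' Set.Icc (0 : ℝ) 1 ∧
    ∀ α ∈ Set.Icc (0 : ℝ) 1, ∀ (φ : BipartiteVector) (r : ℕ) (p : Fin r → ℝ),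
      IsSchmidtCoefficients φ p →
        spectralFunctional α φ = ((∑ i, p i ^ α : ℝ) : ℂ) := by
  refine ⟨Set.Subset.antisymm ?_ ?_, fun α _ φ r p h => ?_⟩
  · rintro _ ⟨f, hf, rfl⟩
    obtain ⟨α, h0, h1, rfl⟩ := S2.exists_eq_spectralHom hf
    exact ⟨α, ⟨h0, h1⟩, funext fun φ => φ.spectralFunctional_eq_singularPowSum α⟩
  · rintro _ ⟨α, ⟨h0, h1⟩, rfl⟩
    exact ⟨S2.spectralHom h0 h1, S2.spectralHom_mem_asymptoticSpectrum h0 h1,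
      funext fun φ => (φ.spectralFunctional_eq_singularPowSum α).symm⟩
  · rw [BipartiteVector.spectralFunctional_eq_singularPowSum,
      (BipartiteVector.isSingularDecomp_of_isSchmidtCoefficients h).singularPowSum_eq]
    congr 1
    exact Finset.sum_congr rfl fun i _ => supportRpow_of_pos (h.1 i)
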